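/- Let $D$ be a probability distribution, let $F(x)=\mathbb{E}_{\xi\sim D}[f(x,\xi)]$ be a differentiable function on $\mathbb{R}^d$, and let $\|\cdot\|$ be the Euclidean norm. Let $\sigma,\widehat\sigma,\beta\ge 0$ and assume: (1) $F^*:=\inf_{x}F(x)>-\infty$; (2) $\mathbb{E}_\xi[\nabla f(x,\xi)]=\nabla F(x)$ and $\mathbb{E}_\xi\|\nabla f(x,\xi)-\nabla F(x)\|^2\le\sigma^2$ for all $x$; (3) $\mathbb{E}_\xi\|\nabla f(x,\xi)-\nabla f(y,\xi)\|^2\le\beta^2\|x-y\|^2$ for all $x,y$; (4) $\|\nabla f(x,\xi)-\nabla f(x,\xi')\|\le 2\widehat\sigma$ for all $x$ and $D$-almost all $\xi,\xi'$. The algorithm META-STORM with $p=\tfrac12$, $q=\tfrac14$ and $a_0=b_0=\eta=1$ draws i.i.d. samples $\xi_1,\xi_2,\dots\sim D$, starts from $x_1\in\mathbb{R}^d$ with $d_1=\nabla f(x_1,\xi_1)$ and $a_1=1$, and computes for $t=1,\dots,T$ $$b_t=\Big(1+\sum_{i=1}^t\|d_i\|^2\Big)^{1/2}\Big/a_t^{1/4},\qquad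 x_{t+1}=x_t-\frac{1}{b_t}d_t,$$ $$a_{t+1}=\Big(1+\sum_{i=1}^t\|\nabla f(x_i,\xi_i)-\nabla f(x_i,\xi_{i+1})\|^2\Big)^{-2/3},$$ $$d_{t+1}=\nabla f(x_{t+1},\xi_{t+1})+(1-a_{t+1})\big(d_t-\nabla f(x_t,\xi_{t+1})\big).$$ Its output is $x_{\mathrm{out}}=x_\tau$, where $\tau$ is uniform on $\{1,\dots,T\}$ and independent of the samples. Then there is an absolute constant $C>0$ (independent of $d$, $D$, $f$, $\sigma$, $\widehat\sigma$, $\beta$, $x_1$ and $T$) such that for all $T\ge 1$, with $\bar\beta:=\max\{\beta,2\}$, $$\mathbb{E}\big[\|\nabla F(x_{\mathrm{out}})\|^{6/7}\big]\le C\Big(Q_1+Q_2\log^{6/7}(1+\sigma^2T)\Big)\Big(\frac{1}{T^{3/7}}+\frac{\sigma^{2/7}}{T^{2/7}}\Big),$$ where $$Q_1=(F(x_1)-F^*)^{6/7}+(\widehat\sigma\sigma)^{6/7}+\sigma^{12/7}+\widehat\sigma^{18/7}+(1+\widehat\sigma^{18/7})\,\bar\beta^{6/7}\log^{6/7}(\bar\beta+\widehat\sigma^3\bar\beta),$$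 $$Q_2=(1+\widehat\sigma^{18/7})\,\bar\beta^{6/7}.$$ No bound on the function values is assumed, and the algorithm uses no knowledge of the problem parameters. -/

import Mathlib

open MeasureTheory ProbabilityTheory

noncomputable section

/-- Parameters of the algorithm: momentum scale `a₀`, step-size offset `b₀`, base step size `η`,
and the two exponents `p`, `q` (used with `p + 2 q = 1`). -/
structure MetaStormParams where
  a₀ : ℝ
  b₀ : ℝ
  η : ℝ
  p : ℝ
  q : ℝ

/-- Everything the algorithm stores at time `t`: the iterate `x t`, the gradient estimate `d t`,
`sumD = ∑_{i=1}^{t} ‖d i‖²` and `sumG = ∑_{i=1}^{t-1} ‖g (x i) (ξ i) - g (x i) (ξ (i+1))‖² / a₀²`. -/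
structure MetaStormState (E : Type*) where
  x : E
  d : E
  sumD : ℝ
  sumG : ℝ

namespace MetaStormState

variable {E : Type*}

/-- The momentum parameter `a t`. -/
def a (s : MetaStormState E) : ℝ := (1 + s.sumG) ^ (-(2 / 3) : ℝ)

/-- The inverse step size `b t`. -/
def b (P : MetaStormParams) (s : MetaStormState E) : ℝ :=
  (P.b₀ ^ (1 / P.p) + s.sumD) ^ P.p / s.a ^ P.q

end MetaStormState

section Algorithm

variable {E Ξ : Type*} [NormedAddCommGroup E] [NormedSpace ℝ E]

/-- The state at time `1`, from the initial point `x₁` and the first sample. -/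
def metaStormInit (g : E → Ξ → E) (x₁ : E) (ξ₁ : Ξ) : MetaStormState E where
  x := x₁
  d := g x₁ ξ₁
  sumD := ‖g x₁ ξ₁‖ ^ 2
  sumG := 0

/-- One iteration: from the state `s` at time `t`, the old sample `ξt` and the new sample `ξt'`
(the samples with indices `t` and `t + 1`), compute the state at time `t + 1`. -/
def metaStormStep (P : MetaStormParams) (g : E → Ξ → E) (s : MetaStormState E) (ξt ξt' : Ξ) :
    MetaStormState E :=
  let x' : E := s.x - (P.η / s.b P) • s.d
  let sumG' : ℝ := s.sumG + ‖g s.x ξt - g s.x ξt'‖ ^ 2 / P.a₀ ^ 2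
  let a' : ℝ := (1 + sumG') ^ (-(2 / 3) : ℝ)
  let d' : E := g x' ξt' + (1 - a') • (s.d - g s.x ξt')
  { x := x', d := d', sumD := s.sumD + ‖d'‖ ^ 2, sumG := sumG' }

/-- The META-STORM algorithm run with the stochastic gradient `g`, the initial point `x₁` and the
sample sequence `ξ 1, ξ 2, …`; `metaStorm P g x₁ ξ t` is the state at time `t ≥ 1`.
The value at `t = 0` is a placeholder, and `ξ 0` influences no state with `t ≥ 1`. -/
def metaStorm (P : MetaStormParams) (g : E → Ξ → E) (x₁ : E) (ξ : ℕ → Ξ) :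
    ℕ → MetaStormState E
  | 0 => metaStormInit g x₁ (ξ 1)
  | 1 => metaStormInit g x₁ (ξ 1)
  | t + 2 => metaStormStep P g (metaStorm P g x₁ ξ (t + 1)) (ξ (t + 1)) (ξ (t + 2))

variable (P : MetaStormParams) (g : E → Ξ → E) (x₁ : E) (ξ : ℕ → Ξ)

theorem metaStorm_x_one : (metaStorm P g x₁ ξ 1).x = x₁ := rfl

theorem metaStorm_d_one : (metaStorm P g x₁ ξ 1).d = g x₁ (ξ 1) := rfl

theorem metaStorm_a_one : (metaStorm P g x₁ ξ 1).a = 1 := by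
  simp [metaStorm, metaStormInit, MetaStormState.a]

theorem metaStorm_sumD (t : ℕ) (ht : 1 ≤ t) :
    (metaStorm P g x₁ ξ t).sumD = ∑ i ∈ Finset.Icc 1 t, ‖(metaStorm P g x₁ ξ i).d‖ ^ 2 := by
  induction t, ht using Nat.le_induction with
  | base => simp [metaStorm, metaStormInit]
  | succ t ht ih =>
    obtain ⟨s, rfl⟩ : ∃ s, t = s + 1 := ⟨t - 1, by omega⟩
    rw [Finset.sum_Icc_succ_top (by omega), ← ih]
    rfl

theorem metaStorm_sumG (t : ℕ) (ht : 1 ≤ t) :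
    (metaStorm P g x₁ ξ (t + 1)).sumG =
      ∑ i ∈ Finset.Icc 1 t, ‖g (metaStorm P g x₁ ξ i).x (ξ i) -
        g (metaStorm P g x₁ ξ i).x (ξ (i + 1))‖ ^ 2 / P.a₀ ^ 2 := by
  induction t, ht using Nat.le_induction with
  | base => simp [metaStorm, metaStormInit, metaStormStep]
  | succ t ht ih =>
    rw [Finset.sum_Icc_succ_top (by omega), ← ih]
    rfl

/-- The update rule of `b t`. -/
theorem metaStorm_b (t : ℕ) (ht : 1 ≤ t) :
    (metaStorm P g x₁ ξ t).b P =
      (P.b₀ ^ (1 / P.p) + ∑ i ∈ Finset.Icc 1 t, ‖(metaStorm P g x₁ ξ i).d‖ ^ 2) ^ P.p /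
        (metaStorm P g x₁ ξ t).a ^ P.q := by
  rw [← metaStorm_sumD P g x₁ ξ t ht]
  rfl

/-- The update rule of `x (t + 1)`. -/
theorem metaStorm_x_succ (t : ℕ) (ht : 1 ≤ t) :
    (metaStorm P g x₁ ξ (t + 1)).x =
      (metaStorm P g x₁ ξ t).x -
        (P.η / (metaStorm P g x₁ ξ t).b P) • (metaStorm P g x₁ ξ t).d := by
  obtain ⟨s, rfl⟩ : ∃ s, t = s + 1 := ⟨t - 1, by omega⟩
  rfl

/-- The update rule of `a (t + 1)`. -/
theorem metaStorm_a_succ (t : ℕ) (ht : 1 ≤ t) :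
    (metaStorm P g x₁ ξ (t + 1)).a =
      (1 + ∑ i ∈ Finset.Icc 1 t, ‖g (metaStorm P g x₁ ξ i).x (ξ i) -
        g (metaStorm P g x₁ ξ i).x (ξ (i + 1))‖ ^ 2 / P.a₀ ^ 2) ^ (-(2 / 3) : ℝ) := by
  rw [← metaStorm_sumG P g x₁ ξ t ht]
  rfl

/-- The update rule of `d (t + 1)`. -/
theorem metaStorm_d_succ (t : ℕ) (ht : 1 ≤ t) :
    (metaStorm P g x₁ ξ (t + 1)).d =
      g (metaStorm P g x₁ ξ (t + 1)).x (ξ (t + 1)) +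
        (1 - (metaStorm P g x₁ ξ (t + 1)).a) •
          ((metaStorm P g x₁ ξ t).d - g (metaStorm P g x₁ ξ t).x (ξ (t + 1))) := by
  obtain ⟨s, rfl⟩ : ∃ s, t = s + 1 := ⟨t - 1, by omega⟩
  rfl

end Algorithm

section Problem

variable {d : ℕ} {Ξ : Type*} [MeasurableSpace Ξ]

/-- The objective `F x = 𝔼_ξ [f (x, ξ)]`, where `ξ` has law `D`. -/
def objective (D : Measure Ξ) (f : EuclideanSpace ℝ (Fin d) → Ξ → ℝ)
    (x : EuclideanSpace ℝ (Fin d)) : ℝ :=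
  ∫ ξ, f x ξ ∂D

/-- The stochastic gradient `∇f (x, ξ)`, the gradient in the variable `x`. -/
def stochGrad (f : EuclideanSpace ℝ (Fin d) → Ξ → ℝ)
    (x : EuclideanSpace ℝ (Fin d)) (ξ : Ξ) : EuclideanSpace ℝ (Fin d) :=
  gradient (fun y => f y ξ) x

/-- The setting of stochastic optimization: all the objects that the assumptions below mention
exist, that is, `F` and `∇F` are defined, `∇f (x, ξ)` is defined almost surely at each `x`, and
it is a measurable function. -/
structure IsStochasticProblem (D : Measure Ξ) (f : EuclideanSpace ℝ (Fin d) → Ξ → ℝ) : Prop where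
  integrable : ∀ x, Integrable (f x) D
  differentiableAt : ∀ x, ∀ᵐ ξ ∂D, DifferentiableAt ℝ (fun y => f y ξ) x
  measurable_grad :
    Measurable (fun z : EuclideanSpace ℝ (Fin d) × Ξ => stochGrad f z.1 z.2)
  differentiable_objective : Differentiable ℝ (objective D f)

/-- The function value is bounded below. -/
def LowerBounded (D : Measure Ξ) (f : EuclideanSpace ℝ (Fin d) → Ξ → ℝ) : Prop :=
  BddBelow (Set.range (objective D f))

/-- The stochastic gradient is an unbiased estimator of `∇F` with variance at most `σ²`. -/
structure UnbiasedBoundedVariance (D : Measure Ξ) (f : EuclideanSpace ℝ (Fin d) → Ξ → ℝ)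
    (σ : ℝ) : Prop where
  integrable : ∀ x, Integrable (stochGrad f x) D
  unbiased : ∀ x, ∫ ξ, stochGrad f x ξ ∂D = gradient (objective D f) x
  integrable_sq :
    ∀ x, Integrable (fun ξ => ‖stochGrad f x ξ - gradient (objective D f) x‖ ^ 2) D
  variance_le :
    ∀ x, ∫ ξ, ‖stochGrad f x ξ - gradient (objective D f) x‖ ^ 2 ∂D ≤ σ ^ 2

/-- Averaged `β`-smoothness. -/
structure AveragedSmooth (D : Measure Ξ) (f : EuclideanSpace ℝ (Fin d) → Ξ → ℝ)
    (β : ℝ) : Prop where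
  integrable_sq : ∀ x y, Integrable (fun ξ => ‖stochGrad f x ξ - stochGrad f y ξ‖ ^ 2) D
  smooth : ∀ x y, ∫ ξ, ‖stochGrad f x ξ - stochGrad f y ξ‖ ^ 2 ∂D ≤ β ^ 2 * ‖x - y‖ ^ 2

/-- Stochastic gradient differences are bounded by `2 σ'`, for `D`-almost all samples. -/
def BoundedGradDifferences (D : Measure Ξ) (f : EuclideanSpace ℝ (Fin d) → Ξ → ℝ)
    (σ' : ℝ) : Prop :=
  ∀ x, ∀ᵐ ξ ∂D, ∀ᵐ ξ' ∂D, ‖stochGrad f x ξ - stochGrad f x ξ'‖ ≤ 2 * σ'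

end Problem

/-- The quantity `Q₁`, with `Δ = F x₁ - F*`. -/
def boundQ₁ (Δ σ σ' β : ℝ) : ℝ :=
  Δ ^ (6 / 7 : ℝ) + (σ' * σ) ^ (6 / 7 : ℝ) + σ ^ (12 / 7 : ℝ) + σ' ^ (18 / 7 : ℝ) +
    (1 + σ' ^ (18 / 7 : ℝ)) * β ^ (6 / 7 : ℝ) * Real.log (β + σ' ^ 3 * β) ^ (6 / 7 : ℝ)

/-- The quantity `Q₂`. -/
def boundQ₂ (σ' β : ℝ) : ℝ :=
  (1 + σ' ^ (18 / 7 : ℝ)) * β ^ (6 / 7 : ℝ)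

end

set_option linter.unusedSectionVars false

/-! Write `w` for the cube root of `1 + ∑ ‖g (x i) (ξ i) - g (x i) (ξ (i + 1))‖²` and `S` for `1 + ∑
‖d i‖²`. Then the momentum parameter is `w⁻²` and the inverse step size is `√(S * w)`. With `e` the
error of the gradient estimate, `n` the noise of the current sample and `k` the noise of the next
sample at the same point, one has `e' = (1 - w'⁻²) (e - k) + n'` and `w'³ = w³ + ‖n - k‖²`.

The difficulty is that `w'` depends on the same fresh sample as `k` and `n'`, so the cross terms do
not average to zero. They do so once `w'` is replaced by `w`, which is determined by the past; the
price is proportional to `w⁻² - w'⁻²`, which telescopes (`momentum_error_sq_le`). The remaining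
noise `w⁻⁴ ‖n‖²` or `w⁻³ ‖n‖²` is charged to the growth of `w³`, since `‖n‖² ≤ ‖n - k‖² + 2⟪n, k⟫`
and the inner product has mean zero; it then telescopes in `w⁻¹` or `log w`. This gives
`sum_integral_inv_le`: the expected error `Y = ∑ w'⁻¹ ‖e‖²` is at most a constant plus multiples of
`𝔼 log S` and `𝔼 log w`. The logarithm of `S` comes from `‖x' - x‖² = ‖d‖² / (S w)` combined with
averaged smoothness.

On the other side, the descent inequality bounds the expectation of `X = ∑ ‖d‖² / √(S w)` by the
initial gap plus the same logarithms, and pathwise `S ≤ w (1 + X)²`. A single variable `W`, affine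
in `X` and `Y`, satisfies `∑ ‖∇F‖² ≤ 2 w W²`, and `log S ≤ log w + 2 log W`. Jensen's inequality
turns the estimates into `V ≤ A + B log V` for `V = 𝔼 W`, which is solved for `V`
(`integral_sum_sq_rpow_le`).

The exponent comes from Hölder's inequality: `(w W²)^(3/7) = (w³)^(1/7) W^(6/7)` has expectation at
most `(𝔼 w³)^(1/7) V^(6/7)`, and `𝔼 w³` grows at most like `1 + σ² T`. Concavity of the power `3/7`
passes from the sum over the iterates to their average. -/

/-- The σ-algebra generated by the samples with indices `0, …, t + 1`. -/
abbrev sampleHistory {Ω Ξ : Type*} [MeasurableSpace Ξ] (ξ : ℕ → Ω → Ξ) (t : ℕ) : MeasurableSpace Ω :=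
  ⨆ i ∈ Set.Iic (t + 1), MeasurableSpace.comap (ξ i) inferInstance

/-! ### Independence of a fresh sample from the past -/

section Independence

variable {Ω Ξ : Type*} [MeasurableSpace Ξ] {ξ : ℕ → Ω → Ξ}

theorem sampleHistory_mono {s t : ℕ} (h : s ≤ t) : sampleHistory ξ s ≤ sampleHistory ξ t :=
  biSup_mono fun i (hi : i ≤ s + 1) => show i ≤ t + 1 by omega

theorem measurable_sample_of_le {i t : ℕ} (h : i ≤ t + 1) :
    Measurable[sampleHistory ξ t] (ξ i) := by
  rw [measurable_iff_comap_le]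
  exact le_biSup (fun i => MeasurableSpace.comap (ξ i) inferInstance) (show i ∈ Set.Iic (t + 1) from h)

variable [MeasurableSpace Ω] {μ : Measure Ω}

theorem sampleHistory_le (hξ : ∀ t, Measurable (ξ t)) (t : ℕ) :
    sampleHistory ξ t ≤ (inferInstance : MeasurableSpace Ω) :=
  iSup₂_le fun i _ => (hξ i).comap_le

theorem indepFun_sample_of_measurable_sampleHistory (hξ : ∀ t, Measurable (ξ t))
    (hind : iIndepFun ξ μ) {β : Type*} [MeasurableSpace β] {Y : Ω → β} {t : ℕ}
    (hY : Measurable[sampleHistory ξ t] Y) : IndepFun Y (ξ (t + 2)) μ := by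
  rw [IndepFun_iff_Indep]
  have h := indep_iSup_of_disjoint (fun i => (hξ i).comap_le) hind.iIndep
    (S := Set.Iic (t + 1)) (T := {t + 2}) (by
      rw [Set.disjoint_singleton_right]; simp)
  refine indep_of_indep_of_le_left (indep_of_indep_of_le_right h ?_) hY.comap_le
  exact le_biSup (fun i => MeasurableSpace.comap (ξ i) inferInstance) (Set.mem_singleton (t + 2))

theorem map_prodMk_sample [IsProbabilityMeasure μ] {D : Measure Ξ} (hξ : ∀ t, Measurable (ξ t))
    (hlaw : ∀ t, μ.map (ξ t) = D) (hind : iIndepFun ξ μ) {β : Type*} [MeasurableSpace β]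
    {Y : Ω → β} {t : ℕ} (hY : Measurable[sampleHistory ξ t] Y) :
    μ.map (fun ω => (Y ω, ξ (t + 2) ω)) = (μ.map Y).prod D := by
  rw [← hlaw (t + 2)]
  exact (indepFun_iff_map_prod_eq_prod_map_map
    (hY.mono (sampleHistory_le hξ t) le_rfl).aemeasurable (hξ _).aemeasurable).1
    (indepFun_sample_of_measurable_sampleHistory hξ hind hY)

variable [IsProbabilityMeasure μ] {D : Measure Ξ} [IsProbabilityMeasure D]

theorem ae_sample_of_forall_ae (hξ : ∀ t, Measurable (ξ t))
    (hlaw : ∀ t, μ.map (ξ t) = D) (hind : iIndepFun ξ μ) {β : Type*} [MeasurableSpace β]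
    {Y : Ω → β} {t : ℕ} (hY : Measurable[sampleHistory ξ t] Y) {p : β × Ξ → Prop}
    (hp : MeasurableSet {z | p z}) (h : ∀ y, ∀ᵐ s ∂D, p (y, s)) :
    ∀ᵐ ω ∂μ, p (Y ω, ξ (t + 2) ω) := by
  have hm : Measurable fun ω => (Y ω, ξ (t + 2) ω) :=
    (hY.mono (sampleHistory_le hξ t) le_rfl).prodMk (hξ _)
  refine ae_of_ae_map hm.aemeasurable (p := p) ?_
  rw [map_prodMk_sample hξ hlaw hind hY]
  exact (Measure.ae_prod_iff_ae_ae hp).2 (.of_forall h)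

theorem integral_sample_eq_zero (hξ : ∀ t, Measurable (ξ t))
    (hlaw : ∀ t, μ.map (ξ t) = D) (hind : iIndepFun ξ μ) {β : Type*} [MeasurableSpace β]
    {Y : Ω → β} {t : ℕ} (hY : Measurable[sampleHistory ξ t] Y) {h : β × Ξ → ℝ}
    (hh : Measurable h) (h0 : ∀ y, ∫ s, h (y, s) ∂D = 0) :
    ∫ ω, h (Y ω, ξ (t + 2) ω) ∂μ = 0 := by
  have hm : Measurable fun ω => (Y ω, ξ (t + 2) ω) :=
    (hY.mono (sampleHistory_le hξ t) le_rfl).prodMk (hξ _)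
  rw [← integral_map hm.aemeasurable (f := h) hh.aestronglyMeasurable,
    map_prodMk_sample hξ hlaw hind hY]
  have := Measure.isProbabilityMeasure_map (μ := μ) (hY.mono (sampleHistory_le hξ t) le_rfl).aemeasurable
  by_cases hi : Integrable h ((μ.map Y).prod D)
  · rw [integral_prod _ hi]; simp [h0]
  -- Without integrability the integral is zero by convention, so the claim needs no integrability
  -- hypothesis.
  · exact integral_undef hi

theorem integral_sample_le (hξ : ∀ t, Measurable (ξ t))
    (hlaw : ∀ t, μ.map (ξ t) = D) (hind : iIndepFun ξ μ) {β : Type*} [MeasurableSpace β]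
    {Y : Ω → β} {t : ℕ} (hY : Measurable[sampleHistory ξ t] Y) {h : β × Ξ → ℝ}
    (hh : Measurable h) {c : β → ℝ} (hc : Measurable c) (hle : ∀ y, ∫ s, h (y, s) ∂D ≤ c y)
    (hi : Integrable (fun ω => h (Y ω, ξ (t + 2) ω)) μ) (hci : Integrable (fun ω => c (Y ω)) μ) :
    ∫ ω, h (Y ω, ξ (t + 2) ω) ∂μ ≤ ∫ ω, c (Y ω) ∂μ := by
  have hYm : Measurable Y := hY.mono (sampleHistory_le hξ t) le_rfl
  have hm : Measurable fun ω => (Y ω, ξ (t + 2) ω) := hYm.prodMk (hξ _)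
  have := Measure.isProbabilityMeasure_map (μ := μ) hYm.aemeasurable
  have hi' := (integrable_map_measure (f := fun ω => (Y ω, ξ (t + 2) ω)) (g := h)
    hh.aestronglyMeasurable hm.aemeasurable).2 hi
  rw [map_prodMk_sample hξ hlaw hind hY] at hi'
  rw [← integral_map hm.aemeasurable (f := h) hh.aestronglyMeasurable,
    map_prodMk_sample hξ hlaw hind hY, integral_prod _ hi',
    ← integral_map hYm.aemeasurable (f := c) hc.aestronglyMeasurable]
  exact integral_mono hi'.integral_prod_left
    ((integrable_map_measure hc.aestronglyMeasurable hYm.aemeasurable).2 hci) hle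

end Independence

/-! ### Pathwise inequalities for one step of the momentum error -/

section Deterministic

variable {E : Type*} [NormedAddCommGroup E] [InnerProductSpace ℝ E]

/-- The cross terms carry the old parameter `a`, not the `a'` of the recursion: `a` will be
determined by the past, so these terms will have mean zero. The exchange costs multiples of `a -
a'`; half of the contraction `a' ‖e‖²` is spent on absorbing it. -/
theorem momentum_error_sq_le {e n k e' : E} {a a' R : ℝ} (ha' : 0 < a') (haa : a' ≤ a)
    (ha : a ≤ 1) (hR : 1 ≤ R) (haR : a ≤ R * a') (he : e' = (1 - a') • (e - k) + n) :
    ‖e'‖ ^ 2 ≤ (1 - a' / 2) * ‖e‖ ^ 2 + (2 * (1 - a) * inner ℝ e n - 2 * (1 - a) ^ 2 * inner ℝ e k)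
      + 4 * R * (a - a') * ‖n‖ ^ 2 + 2 * a' ^ 2 * ‖n‖ ^ 2 + 18 * R * ‖n - k‖ ^ 2 := by
  set z := n - k with hz
  have hk : k = n - z := by simp [hz]
  have he2 : e' = (1 - a') • e + (a' • n + (1 - a') • z) := by
    rw [he, hk]; module
  have hexp : ‖e'‖ ^ 2 = (1 - a') ^ 2 * ‖e‖ ^ 2 + 2 * ((1 - a') * (a' * inner ℝ e n + (1 - a') * inner ℝ e z))
      + ‖a' • n + (1 - a') • z‖ ^ 2 := by
    rw [he2, norm_add_sq_real, norm_smul, mul_pow, inner_smul_left, inner_add_right,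
      inner_smul_right, inner_smul_right, Real.norm_eq_abs, sq_abs]
    simp
  have hM : ‖a' • n + (1 - a') • z‖ ^ 2 ≤ 2 * a' ^ 2 * ‖n‖ ^ 2 + 2 * ‖z‖ ^ 2 := by
    have h1 : ‖a' • n + (1 - a') • z‖ ≤ a' * ‖n‖ + ‖z‖ := by
      refine (norm_add_le _ _).trans ?_
      rw [norm_smul, norm_smul, Real.norm_eq_abs, Real.norm_eq_abs, abs_of_pos ha', abs_of_nonneg (by linarith)]
      nlinarith [norm_nonneg z]
    calc _ ≤ (a' * ‖n‖ + ‖z‖) ^ 2 := by gcongr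
      _ ≤ _ := by nlinarith [sq_nonneg (a' * ‖n‖ - ‖z‖)]
  have hin := abs_le.1 (abs_real_inner_le_norm e n)
  have hiz := abs_le.1 (abs_real_inner_le_norm e z)
  have hkin : inner ℝ e k = inner ℝ e n - inner ℝ e z := by rw [hk, inner_sub_right]
  set p := inner ℝ e n
  set q := inner ℝ e z
  set x := ‖e‖
  set u := ‖n‖
  set v := ‖z‖
  have hx : 0 ≤ x := norm_nonneg _
  have hu : 0 ≤ u := norm_nonneg _
  have hv : 0 ≤ v := norm_nonneg _
  set δ := a - a' with hδ
  have hδ0 : 0 ≤ δ := by linarith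
  have hδR : δ ≤ R * a' := by linarith
  -- replacing `a'` by `a` in the two cross terms
  have hc1 : ((1 - a') * a' - (1 - a) * a) * p ≤ δ * (x * u) := by
    have : ((1 - a') * a' - (1 - a) * a) * p = δ * ((a + a' - 1) * p) := by rw [hδ]; ring
    rw [this]
    refine mul_le_mul_of_nonneg_left ?_ hδ0
    have h1 : |(a + a' - 1) * p| ≤ 1 * (x * u) := by
      rw [abs_mul]
      exact mul_le_mul (abs_le.2 ⟨by linarith, by linarith⟩) (abs_le.2 hin) (abs_nonneg _) zero_le_one
    linarith [le_abs_self ((a + a' - 1) * p)]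
  have hc2 : ((1 - a') ^ 2 - (1 - a) ^ 2) * q ≤ δ * (2 * (x * v)) := by
    have : ((1 - a') ^ 2 - (1 - a) ^ 2) * q = δ * ((2 - a - a') * q) := by rw [hδ]; ring
    rw [this]
    refine mul_le_mul_of_nonneg_left ?_ hδ0
    have h1 : |(2 - a - a') * q| ≤ 2 * (x * v) := by
      rw [abs_mul]
      exact mul_le_mul (abs_le.2 ⟨by linarith, by linarith⟩) (abs_le.2 hiz) (abs_nonneg _) zero_le_two
    linarith [le_abs_self ((2 - a - a') * q)]
  have hsq : (1 - a') ^ 2 * x ^ 2 ≤ (1 - a') * x ^ 2 := by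
    refine mul_le_mul_of_nonneg_right ?_ (sq_nonneg _); nlinarith
  -- Young's inequality with `δ² ≤ R * a' * δ`; the coefficient `a' / 8` makes the two doubled cross
  -- terms use exactly `a' / 2 * ‖e‖²`.
  have young : ∀ y : ℝ, 0 ≤ y → δ * (x * y) ≤ a' / 8 * x ^ 2 + 2 * R * δ * y ^ 2 := by
    intro y hy
    have h1 : 0 ≤ a' * (a' / 8 * x ^ 2 + 2 * R * δ * y ^ 2 - δ * (x * y)) := by
      have h2 : δ * δ * y ^ 2 ≤ (R * a') * δ * y ^ 2 := by gcongr
      nlinarith [sq_nonneg (a' * x - 4 * δ * y)]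
    have := nonneg_of_mul_nonneg_right h1 ha'
    linarith
  have y1 := young u hu
  have y2 := young (2 * v) (by linarith)
  have hδ1 : 16 * R * δ * v ^ 2 ≤ 16 * R * 1 * v ^ 2 := by gcongr; linarith
  have hR1 : 2 * v ^ 2 ≤ 2 * R * v ^ 2 := by gcongr; linarith
  rw [hexp, hkin]
  nlinarith

theorem momentum_error_sq_le_two {e n k e' : E} {a' : ℝ} (ha' : 0 < a') (ha1 : a' ≤ 1)
    (he : e' = (1 - a') • (e - k) + n) :
    ‖e'‖ ^ 2 ≤ 2 * ‖e‖ ^ 2 + 4 * a' ^ 2 * ‖n‖ ^ 2 + 4 * ‖n - k‖ ^ 2 := by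
  set z := n - k with hz
  have hk : k = n - z := by simp [hz]
  have he2 : e' = (1 - a') • e + (a' • n + (1 - a') • z) := by
    rw [he, hk]; module
  have h1 : ‖e'‖ ≤ ‖e‖ + (a' * ‖n‖ + ‖z‖) := by
    rw [he2]
    refine (norm_add_le _ _).trans (add_le_add ?_ ((norm_add_le _ _).trans (add_le_add ?_ ?_))) <;>
      rw [norm_smul, Real.norm_eq_abs]
    · rw [abs_of_nonneg (by linarith)]; nlinarith [norm_nonneg e]
    · rw [abs_of_pos ha']
    · rw [abs_of_nonneg (by linarith)]; nlinarith [norm_nonneg z]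
  calc _ ≤ (‖e‖ + (a' * ‖n‖ + ‖z‖)) ^ 2 := by gcongr
    _ ≤ _ := by nlinarith [sq_nonneg (a' * ‖n‖ - ‖z‖), sq_nonneg (‖e‖ - (a' * ‖n‖ + ‖z‖))]

/-- One step of the potential `‖e‖² + 4 ρ⁵ w⁻²`. -/
theorem momentum_potential_step {e n k e' : E} {w w' ρ : ℝ} (hw : 1 ≤ w) (hww : w ≤ w')
    (hρ : 1 ≤ ρ) (hwρ : w' ≤ ρ * w) (hn : ‖n‖ ^ 2 ≤ ρ ^ 3)
    (he : e' = (1 - (w' ^ 2)⁻¹) • (e - k) + n) :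
    (w' ^ 2)⁻¹ * ‖e‖ ^ 2 ≤ 2 * ((‖e‖ ^ 2 + 4 * ρ ^ 5 * (w ^ 2)⁻¹) - (‖e'‖ ^ 2 + 4 * ρ ^ 5 * (w' ^ 2)⁻¹)
      + (2 * (1 - (w ^ 2)⁻¹) * inner ℝ e n - 2 * (1 - (w ^ 2)⁻¹) ^ 2 * inner ℝ e k)
      + 2 * (w' ^ 4)⁻¹ * ‖n‖ ^ 2 + 18 * ρ ^ 2 * ‖n - k‖ ^ 2) := by
  have hw0 : 0 < w := by linarith
  have hw'0 : 0 < w' := by linarith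
  have haa : (w' ^ 2)⁻¹ ≤ (w ^ 2)⁻¹ := by gcongr
  have ha1 : (w ^ 2)⁻¹ ≤ 1 := inv_le_one_of_one_le₀ (one_le_pow₀ hw)
  have haR : (w ^ 2)⁻¹ ≤ ρ ^ 2 * (w' ^ 2)⁻¹ := by
    rw [← div_eq_mul_inv, le_div_iff₀ (by positivity), inv_mul_le_iff₀ (by positivity)]
    calc w' ^ 2 ≤ (ρ * w) ^ 2 := by gcongr
      _ = _ := by ring
  have h := momentum_error_sq_le (by positivity) haa ha1 (one_le_pow₀ hρ) haR he
  have h2 : ((w' ^ 2)⁻¹) ^ 2 = (w' ^ 4)⁻¹ := by rw [← inv_pow, ← inv_pow]; ring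
  rw [h2] at h
  -- A uniform bound on the noise leaves a pure difference of `w⁻²`, which the second summand of the
  -- potential absorbs.
  have h3 : 4 * ρ ^ 2 * ((w ^ 2)⁻¹ - (w' ^ 2)⁻¹) * ‖n‖ ^ 2 ≤ 4 * ρ ^ 2 * ((w ^ 2)⁻¹ - (w' ^ 2)⁻¹) * ρ ^ 3 := by
    refine mul_le_mul_of_nonneg_left hn (mul_nonneg (by positivity) (by linarith))
  linarith

/-- One step of the potential `w ‖e‖² + 8 ρ⁵ w⁻¹`. -/
theorem momentum_weighted_potential_step {e n k e' : E} {w w' ρ : ℝ} (hw : 1 ≤ w) (hww : w ≤ w')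
    (hρ : 1 ≤ ρ) (hwρ : w' ≤ ρ * w) (hcube : w' ^ 3 - w ^ 3 ≤ ρ ^ 3) (hn : ‖n‖ ^ 2 ≤ ρ ^ 3)
    (he : e' = (1 - (w' ^ 2)⁻¹) • (e - k) + n) :
    w'⁻¹ * ‖e‖ ^ 2 ≤ 2 * ((w * ‖e‖ ^ 2 + 8 * ρ ^ 5 * w⁻¹) - (w' * ‖e'‖ ^ 2 + 8 * ρ ^ 5 * w'⁻¹)
      + w * (2 * (1 - (w ^ 2)⁻¹) * inner ℝ e n - 2 * (1 - (w ^ 2)⁻¹) ^ 2 * inner ℝ e k)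
      + 5 / 2 * ρ ^ 3 * ((w' ^ 2)⁻¹ * ‖e‖ ^ 2)
      + (2 * (w' ^ 3)⁻¹ + 4 * ρ ^ 3 * (w' ^ 4)⁻¹) * ‖n‖ ^ 2 + 22 * ρ ^ 3 * (w * ‖n - k‖ ^ 2)) := by
  have hw0 : 0 < w := by linarith
  have hw'0 : 0 < w' := by linarith
  have hρ0 : 0 < ρ := by linarith
  have haa : (w' ^ 2)⁻¹ ≤ (w ^ 2)⁻¹ := by gcongr
  have ha1 : (w ^ 2)⁻¹ ≤ 1 := inv_le_one_of_one_le₀ (one_le_pow₀ hw)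
  have haR : (w ^ 2)⁻¹ ≤ ρ ^ 2 * (w' ^ 2)⁻¹ := by
    rw [← div_eq_mul_inv, le_div_iff₀ (by positivity), inv_mul_le_iff₀ (by positivity)]
    calc w' ^ 2 ≤ (ρ * w) ^ 2 := by gcongr
      _ = _ := by ring
  have ha'0 : 0 < (w' ^ 2)⁻¹ := by positivity
  have h := momentum_error_sq_le ha'0 haa ha1 (one_le_pow₀ hρ) haR he
  have hh := momentum_error_sq_le_two ha'0 (haa.trans ha1) he
  have h2 : ((w' ^ 2)⁻¹) ^ 2 = (w' ^ 4)⁻¹ := by rw [← inv_pow, ← inv_pow]; ring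
  rw [h2] at h hh
  set a' := (w' ^ 2)⁻¹ with ha'
  set a := (w ^ 2)⁻¹ with ha
  set M := 2 * (1 - a) * inner ℝ e n - 2 * (1 - a) ^ 2 * inner ℝ e k
  -- the growth of the weight
  have hgrow : w' - w ≤ ρ ^ 3 * a' := by
    rw [ha', ← div_eq_mul_inv, le_div_iff₀ (by positivity)]
    nlinarith [mul_le_mul_of_nonneg_left (pow_le_pow_left₀ hw0.le hww 2) hw0.le]
  have hδ : w * (a - a') ≤ 2 * (w⁻¹ - w'⁻¹) := by
    have e1 : a - a' = (w⁻¹ - w'⁻¹) * (w⁻¹ + w'⁻¹) := by rw [ha, ha', ← inv_pow, ← inv_pow]; ring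
    have e2 : w'⁻¹ ≤ w⁻¹ := by gcongr
    have e3 : w * (w⁻¹ + w'⁻¹) ≤ 2 := by
      have : w * w⁻¹ = 1 := mul_inv_cancel₀ hw0.ne'
      nlinarith
    rw [e1]
    calc _ = (w⁻¹ - w'⁻¹) * (w * (w⁻¹ + w'⁻¹)) := by ring
      _ ≤ (w⁻¹ - w'⁻¹) * 2 := mul_le_mul_of_nonneg_left e3 (by linarith)
      _ = _ := by ring
  -- Raising the weight from `w` to `w'` costs `(w' - w) ‖e'‖²`. The growth bound makes this a
  -- multiple of `w'⁻² ‖e‖²` plus noise, which is why the unweighted potential has to be treated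
  -- first.
  have t1 : (w' - w) * ‖e'‖ ^ 2 ≤ ρ ^ 3 * a' * (2 * ‖e‖ ^ 2 + 4 * (w' ^ 4)⁻¹ * ‖n‖ ^ 2 + 4 * ‖n - k‖ ^ 2) := by
    calc _ ≤ (ρ ^ 3 * a') * ‖e'‖ ^ 2 := by gcongr
      _ ≤ _ := by gcongr
  have ha'1 : a' ≤ 1 := haa.trans ha1
  have t2 : w * (4 * ρ ^ 2 * (a - a') * ‖n‖ ^ 2) ≤ 8 * ρ ^ 5 * (w⁻¹ - w'⁻¹) := by
    have h0 : 0 ≤ w * (a - a') := mul_nonneg hw0.le (by linarith)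
    calc _ = 4 * ρ ^ 2 * (w * (a - a')) * ‖n‖ ^ 2 := by ring
      _ ≤ 4 * ρ ^ 2 * (w * (a - a')) * ρ ^ 3 := by gcongr
      _ ≤ 4 * ρ ^ 2 * (2 * (w⁻¹ - w'⁻¹)) * ρ ^ 3 := by gcongr
      _ = _ := by ring
  have t3 : w * (2 * (w' ^ 4)⁻¹ * ‖n‖ ^ 2) ≤ 2 * (w' ^ 3)⁻¹ * ‖n‖ ^ 2 := by
    have : w * (w' ^ 4)⁻¹ ≤ (w' ^ 3)⁻¹ := by
      rw [← div_eq_mul_inv, div_le_iff₀ (by positivity), inv_mul_eq_div, le_div_iff₀ (by positivity)]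
      calc w * w' ^ 3 ≤ w' * w' ^ 3 := by gcongr
        _ = _ := by ring
    nlinarith [mul_le_mul_of_nonneg_right this (sq_nonneg ‖n‖)]
  have t4 : ρ ^ 3 * a' * (4 * (w' ^ 4)⁻¹ * ‖n‖ ^ 2) ≤ 4 * ρ ^ 3 * (w' ^ 4)⁻¹ * ‖n‖ ^ 2 := by
    calc _ ≤ ρ ^ 3 * 1 * (4 * (w' ^ 4)⁻¹ * ‖n‖ ^ 2) := by gcongr
      _ = _ := by ring
  have t5 : ρ ^ 3 * a' * (4 * ‖n - k‖ ^ 2) ≤ 4 * ρ ^ 3 * (w * ‖n - k‖ ^ 2) := by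
    calc _ ≤ ρ ^ 3 * w * (4 * ‖n - k‖ ^ 2) := by gcongr; linarith
      _ = _ := by ring
  have t6 : w * (18 * ρ ^ 2 * ‖n - k‖ ^ 2) ≤ 18 * ρ ^ 3 * (w * ‖n - k‖ ^ 2) := by
    calc _ = 18 * ρ ^ 2 * (w * ‖n - k‖ ^ 2) := by ring
      _ ≤ 18 * ρ ^ 3 * (w * ‖n - k‖ ^ 2) := by
          have : ρ ^ 2 ≤ ρ ^ 3 := pow_le_pow_right₀ hρ (by norm_num)
          gcongr
  have t7 : w'⁻¹ * ‖e‖ ^ 2 ≤ w * a' * ‖e‖ ^ 2 + ρ ^ 3 * (a' * ‖e‖ ^ 2) := by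
    have e1 : w'⁻¹ = w' * a' := by rw [ha']; field_simp
    have e2 : (w' - w) * a' ≤ ρ ^ 3 * a' := by
      calc _ ≤ (ρ ^ 3 * a') * a' := by gcongr
        _ ≤ (ρ ^ 3 * a') * 1 := by gcongr
        _ = _ := by ring
    have e3 := mul_le_mul_of_nonneg_right e2 (sq_nonneg ‖e‖)
    calc w'⁻¹ * ‖e‖ ^ 2 = w * a' * ‖e‖ ^ 2 + (w' - w) * a' * ‖e‖ ^ 2 := by rw [e1]; ring
      _ ≤ w * a' * ‖e‖ ^ 2 + ρ ^ 3 * a' * ‖e‖ ^ 2 := by gcongr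
      _ = _ := by ring
  have hw1 := mul_le_mul_of_nonneg_left h hw0.le
  linarith

/-- A discrete form of `∫ x⁻⁴ d(x³) = 3 ∫ x⁻² dx`. The integrand is taken at the left endpoint,
since the later weight is not determined by the past; the ratio bound pays for this by powers of
`ρ`. -/
theorem inv_pow_four_mul_cube_sub_le {w w' ρ : ℝ} (hw : 1 ≤ w) (hww : w ≤ w') (hρ : 1 ≤ ρ)
    (hwρ : w' ≤ ρ * w) : (w ^ 4)⁻¹ * (w' ^ 3 - w ^ 3) ≤ 3 * ρ ^ 4 * (w⁻¹ - w'⁻¹) := by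
  have hw0 : 0 < w := by linarith
  have hw'0 : 0 < w' := by linarith
  have e : w⁻¹ - w'⁻¹ = (w' - w) / (w * w') := by field_simp
  rw [e, inv_mul_le_iff₀ (by positivity)]
  have h1 : w' ^ 3 - w ^ 3 ≤ 3 * w' ^ 2 * (w' - w) := by nlinarith [mul_nonneg (sub_nonneg.2 hww) (sub_nonneg.2 hww), sq_nonneg (w' - w)]
  have h2 : w' ^ 2 * (w * w') ≤ w ^ 4 * ρ ^ 4 := by
    calc w' ^ 2 * (w * w') ≤ (ρ * w) ^ 2 * (w * (ρ * w)) := by gcongr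
      _ = w ^ 4 * ρ ^ 3 * 1 := by ring
      _ ≤ w ^ 4 * ρ ^ 3 * ρ := by gcongr
      _ = _ := by ring
  calc _ ≤ 3 * w' ^ 2 * (w' - w) := h1
    _ = 3 * (w' ^ 2 * (w * w')) * (w' - w) / (w * w') := by field_simp
    _ ≤ 3 * (w ^ 4 * ρ ^ 4) * (w' - w) / (w * w') := by
        have := sub_nonneg.2 hww
        gcongr
    _ = _ := by ring

/-- The borderline case `∫ x⁻³ d(x³) = 3 ∫ x⁻¹ dx`, which produces the logarithm. -/
theorem inv_cube_mul_cube_sub_le {w w' ρ : ℝ} (hw : 1 ≤ w) (hww : w ≤ w') (hwρ : w' ≤ ρ * w) :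
    (w ^ 3)⁻¹ * (w' ^ 3 - w ^ 3) ≤ 3 * ρ ^ 3 * (Real.log w' - Real.log w) := by
  have hw0 : 0 < w := by linarith
  have hw'0 : 0 < w' := by linarith
  have h1 : 1 - w ^ 3 / w' ^ 3 ≤ 3 * (Real.log w' - Real.log w) := by
    have := Real.log_le_sub_one_of_pos (x := w ^ 3 / w' ^ 3) (by positivity)
    rw [Real.log_div (by positivity) (by positivity), Real.log_pow, Real.log_pow] at this
    push_cast at this
    linarith
  have h2 : w' ^ 3 ≤ w ^ 3 * ρ ^ 3 := by
    calc w' ^ 3 ≤ (ρ * w) ^ 3 := by gcongr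
      _ = _ := by ring
  have h3 : 0 ≤ 1 - w ^ 3 / w' ^ 3 := by
    rw [sub_nonneg, div_le_one (by positivity)]; gcongr
  rw [inv_mul_le_iff₀ (by positivity)]
  calc w' ^ 3 - w ^ 3 = w' ^ 3 * (1 - w ^ 3 / w' ^ 3) := by field_simp
    _ ≤ (w ^ 3 * ρ ^ 3) * (1 - w ^ 3 / w' ^ 3) := by gcongr
    _ ≤ (w ^ 3 * ρ ^ 3) * (3 * (Real.log w' - Real.log w)) := by
        have : 0 ≤ ρ := by nlinarith
        gcongr
    _ = _ := by ring

end Deterministic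

/-! ### Almost surely bounded functions, for which integrability is automatic -/

/-- A measurable function that is almost surely bounded. -/
def EssBounded {Ω F : Type*} [MeasurableSpace Ω] (μ : Measure Ω) [NormedAddCommGroup F]
    [MeasurableSpace F] (f : Ω → F) : Prop :=
  Measurable f ∧ ∃ C, ∀ᵐ ω ∂μ, ‖f ω‖ ≤ C

namespace EssBounded

variable {Ω F : Type*} [MeasurableSpace Ω] {μ : Measure Ω} [NormedAddCommGroup F]
  [MeasurableSpace F] {f g : Ω → F}

theorem measurable (hf : EssBounded μ f) : Measurable f := hf.1

theorem mono_ae {G : Type*} [NormedAddCommGroup G] [MeasurableSpace G] {h : Ω → G}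
    (hf : EssBounded μ f) (hh : Measurable h) (hle : ∀ᵐ ω ∂μ, ‖h ω‖ ≤ ‖f ω‖) : EssBounded μ h := by
  obtain ⟨_, C, hC⟩ := hf
  exact ⟨hh, C, by filter_upwards [hC, hle] with ω h1 h2 using h2.trans h1⟩

theorem const (c : F) : EssBounded μ fun _ => c := ⟨measurable_const, ‖c‖, by simp⟩

theorem add [BorelSpace F] [SecondCountableTopology F] (hf : EssBounded μ f)
    (hg : EssBounded μ g) : EssBounded μ fun ω => f ω + g ω := by
  obtain ⟨hf, C, hC⟩ := hf
  obtain ⟨hg, C', hC'⟩ := hg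
  exact ⟨hf.add hg, C + C', by
    filter_upwards [hC, hC'] with ω h1 h2 using (norm_add_le _ _).trans (add_le_add h1 h2)⟩

theorem sub [BorelSpace F] [SecondCountableTopology F] (hf : EssBounded μ f)
    (hg : EssBounded μ g) : EssBounded μ fun ω => f ω - g ω := by
  obtain ⟨hf, C, hC⟩ := hf
  obtain ⟨hg, C', hC'⟩ := hg
  exact ⟨hf.sub hg, C + C', by
    filter_upwards [hC, hC'] with ω h1 h2 using (norm_sub_le _ _).trans (add_le_add h1 h2)⟩

theorem norm [BorelSpace F] (hf : EssBounded μ f) : EssBounded μ fun ω => ‖f ω‖ :=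
  hf.mono_ae hf.1.norm (by simp)

theorem mul {f g : Ω → ℝ} (hf : EssBounded μ f) (hg : EssBounded μ g) :
    EssBounded μ fun ω => f ω * g ω := by
  obtain ⟨hf, C, hC⟩ := hf
  obtain ⟨hg, C', hC'⟩ := hg
  refine ⟨hf.mul hg, C * C', ?_⟩
  filter_upwards [hC, hC'] with ω h1 h2
  rw [norm_mul]
  exact mul_le_mul h1 h2 (norm_nonneg _) ((norm_nonneg _).trans h1)

theorem const_mul {f : Ω → ℝ} (c : ℝ) (hf : EssBounded μ f) : EssBounded μ fun ω => c * f ω :=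
  (const c).mul hf

theorem pow {f : Ω → ℝ} (hf : EssBounded μ f) (n : ℕ) : EssBounded μ fun ω => f ω ^ n := by
  induction n with
  | zero => simpa using const (1 : ℝ)
  | succ n ih => simpa only [pow_succ] using ih.mul hf

theorem smul [BorelSpace F] [NormedSpace ℝ F] [SecondCountableTopology F] {c : Ω → ℝ}
    (hc : EssBounded μ c) (hf : EssBounded μ f) : EssBounded μ fun ω => c ω • f ω :=
  (hc.mul hf.norm).mono_ae (hc.1.smul hf.1) (by simp [norm_smul])

theorem inner [BorelSpace F] [InnerProductSpace ℝ F] [SecondCountableTopology F]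
    (hf : EssBounded μ f) (hg : EssBounded μ g) : EssBounded μ fun ω => inner ℝ (f ω) (g ω) :=
  (hf.norm.mul hg.norm).mono_ae (hf.1.inner hg.1)
    (.of_forall fun ω => by simpa using norm_inner_le_norm (𝕜 := ℝ) (f ω) (g ω))

theorem sum {f : ℕ → Ω → ℝ} (s : Finset ℕ) (hf : ∀ i ∈ s, EssBounded μ (f i)) :
    EssBounded μ fun ω => ∑ i ∈ s, f i ω := by
  induction s using Finset.induction_on with
  | empty => simpa using const (0 : ℝ)
  | insert a s ha ih =>
    simp only [Finset.sum_insert ha]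
    exact (hf a (by simp)).add (ih fun i hi => hf i (by simp [hi]))

theorem inv_of_one_le {f : Ω → ℝ} (hf : Measurable f) (h1 : ∀ ω, 1 ≤ f ω) :
    EssBounded μ fun ω => (f ω)⁻¹ :=
  ⟨hf.inv, 1, .of_forall fun ω => by
    rw [Real.norm_eq_abs, abs_of_nonneg (inv_nonneg.2 (zero_le_one.trans (h1 ω)))]
    exact inv_le_one_of_one_le₀ (h1 ω)⟩

theorem log_of_one_le {f : Ω → ℝ} (hf : EssBounded μ f) (h1 : ∀ ω, 1 ≤ f ω) :
    EssBounded μ fun ω => Real.log (f ω) :=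
  hf.mono_ae (Real.measurable_log.comp hf.1) (.of_forall fun ω => by
    have h0 : 0 < f ω := zero_lt_one.trans_le (h1 ω)
    rw [Real.norm_eq_abs, Real.norm_eq_abs, abs_of_pos h0, abs_of_nonneg (Real.log_nonneg (h1 ω))]
    linarith [Real.log_le_sub_one_of_pos h0])

theorem integrable [BorelSpace F] [SecondCountableTopology F] [IsFiniteMeasure μ]
    (hf : EssBounded μ f) : Integrable f μ := by
  obtain ⟨hf, C, hC⟩ := hf
  exact Integrable.of_bound hf.aestronglyMeasurable C hC

end EssBounded

/-! ### Expected error of the momentum estimator -/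

/-- The error `e t` of a momentum gradient estimator with momentum parameter `(w t)⁻²`:
`n t` is the noise of the fresh sample at the current iterate, `k t` the noise of the next sample
at the same iterate. -/
structure MomentumErrorProcess {Ω E : Type*} [MeasurableSpace Ω] [NormedAddCommGroup E]
    [InnerProductSpace ℝ E] [MeasurableSpace E] (μ : Measure Ω) (ℱ : ℕ → MeasurableSpace Ω)
    (w : ℕ → Ω → ℝ) (e n k : ℕ → Ω → E) (ρ : ℝ) : Prop where
  one_le_rho : 1 ≤ ρ
  w_zero : ∀ ω, w 0 ω = 1
  w_nonneg : ∀ t ω, 0 ≤ w t ω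
  w_succ : ∀ t ω, w (t + 1) ω ^ 3 = w t ω ^ 3 + ‖n t ω - k t ω‖ ^ 2
  e_zero : ∀ ω, e 0 ω = n 0 ω
  e_succ : ∀ t ω, e (t + 1) ω = (1 - (w (t + 1) ω ^ 2)⁻¹) • (e t ω - k t ω) + n (t + 1) ω
  measurable_n : ∀ t, Measurable (n t)
  measurable_k : ∀ t, Measurable (k t)
  measurable_e : ∀ t, Measurable (e t)
  measurable_w : ∀ t, Measurable (w t)
  norm_n : ∀ t, ∀ᵐ ω ∂μ, 4 * ‖n t ω‖ ^ 2 ≤ ρ ^ 3 - 1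
  norm_k : ∀ t, ∀ᵐ ω ∂μ, 4 * ‖k t ω‖ ^ 2 ≤ ρ ^ 3 - 1
  adapted_w : ∀ t, Measurable[ℱ t] (w t)
  adapted_e : ∀ t, Measurable[ℱ t] (e t)
  adapted_n : ∀ t, Measurable[ℱ t] (n t)
  integral_inner_n : ∀ t (v : Ω → E), Measurable[ℱ t] v →
    ∫ ω, inner ℝ (v ω) (n (t + 1) ω) ∂μ = 0
  integral_inner_k : ∀ t (v : Ω → E), Measurable[ℱ t] v → ∫ ω, inner ℝ (v ω) (k t ω) ∂μ = 0


namespace MomentumErrorProcess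

variable {Ω E : Type*} [MeasurableSpace Ω] [NormedAddCommGroup E]
  [InnerProductSpace ℝ E] [MeasurableSpace E] [BorelSpace E] [SecondCountableTopology E]
  {μ : Measure Ω} [IsProbabilityMeasure μ] {ℱ : ℕ → MeasurableSpace Ω}
  {w : ℕ → Ω → ℝ} {e n k : ℕ → Ω → E} {ρ : ℝ}

theorem w_mono (h : MomentumErrorProcess μ ℱ w e n k ρ) (t : ℕ) (ω : Ω) :
    w t ω ≤ w (t + 1) ω := by
  refine le_of_pow_le_pow_left₀ (n := 3) (by norm_num) (h.w_nonneg _ _) ?_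
  rw [h.w_succ]; linarith [sq_nonneg ‖n t ω - k t ω‖]

theorem one_le_w (h : MomentumErrorProcess μ ℱ w e n k ρ) (t : ℕ) (ω : Ω) : 1 ≤ w t ω := by
  induction t with
  | zero => rw [h.w_zero]
  | succ t ih => exact ih.trans (h.w_mono t ω)

theorem norm_sub_sq_le (h : MomentumErrorProcess μ ℱ w e n k ρ) (t : ℕ) :
    ∀ᵐ ω ∂μ, ‖n t ω - k t ω‖ ^ 2 ≤ ρ ^ 3 - 1 := by
  filter_upwards [h.norm_n t, h.norm_k t] with ω h1 h2
  have h3 : ‖n t ω - k t ω‖ ^ 2 ≤ (‖n t ω‖ + ‖k t ω‖) ^ 2 := by gcongr; exact norm_sub_le _ _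
  nlinarith [sq_nonneg (‖n t ω‖ - ‖k t ω‖)]

theorem w_succ_le (h : MomentumErrorProcess μ ℱ w e n k ρ) (t : ℕ) :
    ∀ᵐ ω ∂μ, w (t + 1) ω ≤ ρ * w t ω := by
  filter_upwards [h.norm_sub_sq_le t] with ω h1
  have h2 := h.one_le_w t ω
  have hρ := h.one_le_rho
  refine le_of_pow_le_pow_left₀ (n := 3) (by norm_num) (by positivity) ?_
  rw [h.w_succ, mul_pow]
  have h3 : 1 ≤ w t ω ^ 3 := one_le_pow₀ h2
  have h4 : 1 ≤ ρ ^ 3 := one_le_pow₀ hρ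
  nlinarith

theorem essBounded_n (h : MomentumErrorProcess μ ℱ w e n k ρ) (t : ℕ) : EssBounded μ (n t) :=
  ⟨h.measurable_n t, ρ ^ 3, by
    filter_upwards [h.norm_n t] with ω h1
    nlinarith [sq_nonneg (‖n t ω‖ - 1 / 2)]⟩

theorem essBounded_k (h : MomentumErrorProcess μ ℱ w e n k ρ) (t : ℕ) : EssBounded μ (k t) :=
  ⟨h.measurable_k t, ρ ^ 3, by
    filter_upwards [h.norm_k t] with ω h1
    nlinarith [sq_nonneg (‖k t ω‖ - 1 / 2)]⟩

theorem essBounded_w (h : MomentumErrorProcess μ ℱ w e n k ρ) (t : ℕ) : EssBounded μ (w t) := by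
  induction t with
  | zero => simpa only [h.w_zero] using (show EssBounded μ (w 0) from ⟨h.measurable_w 0, 1, by simp [h.w_zero]⟩)
  | succ t ih =>
    refine (ih.const_mul ρ).mono_ae (h.measurable_w _) ?_
    filter_upwards [h.w_succ_le t] with ω h1
    rw [Real.norm_eq_abs, Real.norm_eq_abs, abs_of_nonneg (h.w_nonneg _ _)]
    exact h1.trans (le_abs_self _)

theorem essBounded_inv_w (h : MomentumErrorProcess μ ℱ w e n k ρ) (t : ℕ) :
    EssBounded μ fun ω => (w t ω)⁻¹ :=
  .inv_of_one_le (h.measurable_w t) (h.one_le_w t)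

theorem essBounded_inv_w_pow (h : MomentumErrorProcess μ ℱ w e n k ρ) (t j : ℕ) :
    EssBounded μ fun ω => (w t ω ^ j)⁻¹ :=
  .inv_of_one_le ((h.measurable_w t).pow_const j) fun ω => one_le_pow₀ (h.one_le_w t ω)

theorem essBounded_e (h : MomentumErrorProcess μ ℱ w e n k ρ) (t : ℕ) : EssBounded μ (e t) := by
  induction t with
  | zero => rw [show e 0 = n 0 from funext h.e_zero]; exact h.essBounded_n 0
  | succ t ih =>
    rw [show e (t + 1) = fun ω => (1 - (w (t + 1) ω ^ 2)⁻¹) • (e t ω - k t ω) + n (t + 1) ω from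
      funext (h.e_succ t)]
    exact (((EssBounded.const 1).sub (h.essBounded_inv_w_pow (t + 1) 2)).smul
      (ih.sub (h.essBounded_k t))).add (h.essBounded_n (t + 1))

theorem essBounded_inv_w_mul_sq (h : MomentumErrorProcess μ ℱ w e n k ρ) (t : ℕ) :
    EssBounded μ fun ω => (w (t + 1) ω)⁻¹ * ‖e t ω‖ ^ 2 :=
  (h.essBounded_inv_w _).mul ((h.essBounded_e t).norm.pow 2)

theorem essBounded_w_mul_sq (h : MomentumErrorProcess μ ℱ w e n k ρ) (t : ℕ) :
    EssBounded μ fun ω => w t ω * ‖n (t + 1) ω - k t ω‖ ^ 2 :=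
  (h.essBounded_w _).mul (((h.essBounded_n (t + 1)).sub (h.essBounded_k t)).norm.pow 2)

theorem integral_mul_inner_n (h : MomentumErrorProcess μ ℱ w e n k ρ) (t : ℕ) {c : Ω → ℝ}
    {v : Ω → E} (hc : Measurable[ℱ t] c) (hv : Measurable[ℱ t] v) :
    ∫ ω, c ω * inner ℝ (v ω) (n (t + 1) ω) ∂μ = 0 := by
  have := h.integral_inner_n t (fun ω => c ω • v ω) (hc.smul hv)
  simpa only [real_inner_smul_left] using this

theorem integral_mul_inner_k (h : MomentumErrorProcess μ ℱ w e n k ρ) (t : ℕ) {c : Ω → ℝ}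
    {v : Ω → E} (hc : Measurable[ℱ t] c) (hv : Measurable[ℱ t] v) :
    ∫ ω, c ω * inner ℝ (v ω) (k t ω) ∂μ = 0 := by
  have := h.integral_inner_k t (fun ω => c ω • v ω) (hc.smul hv)
  simpa only [real_inner_smul_left] using this

/-- The mean-zero part of one step of the recursion, with weights `c t` and `c' (t + 1)`. -/
theorem integral_cross_terms (h : MomentumErrorProcess μ ℱ w e n k ρ) (t : ℕ) {c c' : Ω → ℝ}
    (hc : Measurable[ℱ t] c) (hcb : EssBounded μ c) (hc' : Measurable[ℱ (t + 1)] c')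
    (hcb' : EssBounded μ c') :
    EssBounded μ (fun ω => c ω * (2 * (1 - (w t ω ^ 2)⁻¹) * inner ℝ (e t ω) (n (t + 1) ω)
      - 2 * (1 - (w t ω ^ 2)⁻¹) ^ 2 * inner ℝ (e t ω) (k t ω))
      + c' ω * inner ℝ (n (t + 1) ω) (k (t + 1) ω)) ∧
    ∫ ω, (c ω * (2 * (1 - (w t ω ^ 2)⁻¹) * inner ℝ (e t ω) (n (t + 1) ω)
      - 2 * (1 - (w t ω ^ 2)⁻¹) ^ 2 * inner ℝ (e t ω) (k t ω))
      + c' ω * inner ℝ (n (t + 1) ω) (k (t + 1) ω)) ∂μ = 0 := by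
  have hb : EssBounded μ fun ω => 1 - (w t ω ^ 2)⁻¹ :=
    (EssBounded.const 1).sub (h.essBounded_inv_w_pow t 2)
  have hbm : Measurable[ℱ t] fun ω => 1 - (w t ω ^ 2)⁻¹ :=
    measurable_const.sub ((h.adapted_w t).pow_const 2).inv
  have b1 : EssBounded μ fun ω => c ω * (2 * (1 - (w t ω ^ 2)⁻¹)) * inner ℝ (e t ω) (n (t + 1) ω) :=
    (hcb.mul (hb.const_mul 2)).mul ((h.essBounded_e t).inner (h.essBounded_n _))
  have b2 : EssBounded μ fun ω => c ω * (2 * (1 - (w t ω ^ 2)⁻¹) ^ 2) * inner ℝ (e t ω) (k t ω) :=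
    (hcb.mul ((hb.pow 2).const_mul 2)).mul ((h.essBounded_e t).inner (h.essBounded_k _))
  have b3 : EssBounded μ fun ω => c' ω * inner ℝ (n (t + 1) ω) (k (t + 1) ω) :=
    hcb'.mul ((h.essBounded_n _).inner (h.essBounded_k _))
  have i1 := h.integral_mul_inner_n t (hc.mul (hbm.const_mul 2)) (h.adapted_e t)
  have i2 := h.integral_mul_inner_k t (hc.mul ((hbm.pow_const 2).const_mul 2)) (h.adapted_e t)
  have i3 := h.integral_mul_inner_k (t + 1) hc' (h.adapted_n (t + 1))
  simp only [Pi.mul_apply] at i1 i2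
  simp only [mul_sub, ← mul_assoc] at b1 b2 b3 i1 i2 i3 ⊢
  refine ⟨(b1.sub b2).add b3, ?_⟩
  rw [integral_add (b1.sub b2).integrable b3.integrable, integral_sub b1.integrable b2.integrable,
    i1, i2, i3]
  simp

/-- The noise is charged to the growth of `w³`. The inner product has mean zero, even with a weight
from the past, because `k t` involves a sample later than `n t`. -/
theorem norm_sq_succ_le (h : MomentumErrorProcess μ ℱ w e n k ρ) (t : ℕ) (ω : Ω) :
    ‖n t ω‖ ^ 2 ≤ (w (t + 1) ω ^ 3 - w t ω ^ 3) + 2 * inner ℝ (n t ω) (k t ω) := by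
  rw [h.w_succ, norm_sub_sq_real]; nlinarith [sq_nonneg ‖k t ω‖]

theorem norm_n_sq_le (h : MomentumErrorProcess μ ℱ w e n k ρ) (t : ℕ) :
    ∀ᵐ ω ∂μ, ‖n t ω‖ ^ 2 ≤ ρ ^ 3 := by
  filter_upwards [h.norm_n t] with ω h1
  nlinarith [sq_nonneg ‖n t ω‖]

/-- `M` collects all mean-zero terms. The extra summand `6 * ρ ^ 4 * (w (t + 1) ω)⁻¹` of the
potential absorbs the noise `2 * w⁻⁴ * ‖n‖²`, and is indexed one step ahead because this noise is
charged to the next increment of `w³`. -/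
theorem step_le (h : MomentumErrorProcess μ ℱ w e n k ρ) (t : ℕ) :
    ∃ M : Ω → ℝ, EssBounded μ M ∧ ∫ ω, M ω ∂μ = 0 ∧ ∀ᵐ ω ∂μ,
      (w (t + 1) ω ^ 2)⁻¹ * ‖e t ω‖ ^ 2 ≤ 2 *
        ((‖e t ω‖ ^ 2 + 4 * ρ ^ 5 * (w t ω ^ 2)⁻¹ + 6 * ρ ^ 4 * (w (t + 1) ω)⁻¹)
        - (‖e (t + 1) ω‖ ^ 2 + 4 * ρ ^ 5 * (w (t + 1) ω ^ 2)⁻¹ + 6 * ρ ^ 4 * (w (t + 2) ω)⁻¹)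
        + M ω + 18 * ρ ^ 2 * (w t ω * ‖n (t + 1) ω - k t ω‖ ^ 2)) := by
  obtain ⟨hM, hM0⟩ := h.integral_cross_terms t (c := fun _ => 1)
    (c' := fun ω => 4 * (w (t + 1) ω ^ 4)⁻¹) measurable_const (.const 1)
    (((h.adapted_w (t + 1)).pow_const 4).inv.const_mul 4)
    ((h.essBounded_inv_w_pow (t + 1) 4).const_mul 4)
  refine ⟨_, hM, hM0, ?_⟩
  filter_upwards [h.w_succ_le t, h.w_succ_le (t + 1), h.norm_n_sq_le (t + 1)] with ω h1 h2 h3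
  have s1 := momentum_potential_step (h.one_le_w t ω) (h.w_mono t ω) h.one_le_rho h1 h3
    (h.e_succ t ω)
  have s2 := inv_pow_four_mul_cube_sub_le (h.one_le_w (t + 1) ω) (h.w_mono (t + 1) ω) h.one_le_rho h2
  have s3 := mul_le_mul_of_nonneg_left (h.norm_sq_succ_le (t + 1) ω)
    (inv_nonneg.2 (pow_nonneg (h.w_nonneg (t + 1) ω) 4))
  have s4 : 18 * ρ ^ 2 * ‖n (t + 1) ω - k t ω‖ ^ 2
      ≤ 18 * ρ ^ 2 * (w t ω * ‖n (t + 1) ω - k t ω‖ ^ 2) := by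
    gcongr
    exact le_mul_of_one_le_left (sq_nonneg _) (h.one_le_w t ω)
  rw [mul_add] at s3
  linarith

/-- Here the noise has both weights `w⁻³` and `w⁻⁴`. The first is absorbed by the logarithm in the
potential, the second by the summand with `ρ ^ 7`. -/
theorem weighted_step_le (h : MomentumErrorProcess μ ℱ w e n k ρ) (t : ℕ) :
    ∃ M : Ω → ℝ, EssBounded μ M ∧ ∫ ω, M ω ∂μ = 0 ∧ ∀ᵐ ω ∂μ,
      (w (t + 1) ω)⁻¹ * ‖e t ω‖ ^ 2 ≤ 2 *
        ((w t ω * ‖e t ω‖ ^ 2 + 8 * ρ ^ 5 * (w t ω)⁻¹ + 12 * ρ ^ 7 * (w (t + 1) ω)⁻¹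
          - 6 * ρ ^ 3 * Real.log (w (t + 1) ω))
        - (w (t + 1) ω * ‖e (t + 1) ω‖ ^ 2 + 8 * ρ ^ 5 * (w (t + 1) ω)⁻¹
          + 12 * ρ ^ 7 * (w (t + 2) ω)⁻¹ - 6 * ρ ^ 3 * Real.log (w (t + 2) ω))
        + M ω + (5 / 2 * ρ ^ 3 * ((w (t + 1) ω ^ 2)⁻¹ * ‖e t ω‖ ^ 2)
        + 22 * ρ ^ 3 * (w t ω * ‖n (t + 1) ω - k t ω‖ ^ 2))) := by
  obtain ⟨hM, hM0⟩ := h.integral_cross_terms t (c := w t)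
    (c' := fun ω => 2 * (2 * (w (t + 1) ω ^ 3)⁻¹ + 4 * ρ ^ 3 * (w (t + 1) ω ^ 4)⁻¹))
    (h.adapted_w t) (h.essBounded_w t)
    (((((h.adapted_w (t + 1)).pow_const 3).inv.const_mul 2).add
      (((h.adapted_w (t + 1)).pow_const 4).inv.const_mul _)).const_mul 2)
    ((((h.essBounded_inv_w_pow (t + 1) 3).const_mul 2).add
      ((h.essBounded_inv_w_pow (t + 1) 4).const_mul _)).const_mul 2)
  refine ⟨_, hM, hM0, ?_⟩
  filter_upwards [h.w_succ_le t, h.w_succ_le (t + 1), h.norm_n_sq_le (t + 1),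
    h.norm_sub_sq_le t] with ω h1 h2 h3 h4
  have hρ := h.one_le_rho
  have s1 := momentum_weighted_potential_step (h.one_le_w t ω) (h.w_mono t ω) hρ h1
    (by rw [h.w_succ]; linarith) h3 (h.e_succ t ω)
  have s2 := inv_pow_four_mul_cube_sub_le (h.one_le_w (t + 1) ω) (h.w_mono (t + 1) ω) hρ h2
  have s2' := inv_cube_mul_cube_sub_le (h.one_le_w (t + 1) ω) (h.w_mono (t + 1) ω) h2
  have hw0 := h.w_nonneg (t + 1) ω
  have s3 := mul_le_mul_of_nonneg_left (h.norm_sq_succ_le (t + 1) ω)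
    (show 0 ≤ 2 * (w (t + 1) ω ^ 3)⁻¹ + 4 * ρ ^ 3 * (w (t + 1) ω ^ 4)⁻¹ by positivity)
  have s5 := mul_le_mul_of_nonneg_left s2 (show 0 ≤ 4 * ρ ^ 3 by positivity)
  have e1 : 4 * ρ ^ 3 * (3 * ρ ^ 4 * ((w (t + 1) ω)⁻¹ - (w (t + 2) ω)⁻¹))
    = 12 * ρ ^ 7 * (w (t + 1) ω)⁻¹ - 12 * ρ ^ 7 * (w (t + 2) ω)⁻¹ := by ring
  have e2 : 2 * (3 * ρ ^ 3 * (Real.log (w (t + 2) ω) - Real.log (w (t + 1) ω)))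
    = 6 * ρ ^ 3 * Real.log (w (t + 2) ω) - 6 * ρ ^ 3 * Real.log (w (t + 1) ω) := by ring
  refine s1.trans (mul_le_mul_of_nonneg_left ?_ zero_le_two)
  linarith

theorem integral_step_le {f Φ Φ' Z : Ω → ℝ} (hf : EssBounded μ f) (hΦ : EssBounded μ Φ)
    (hΦ' : EssBounded μ Φ') (hZ : EssBounded μ Z)
    (hle : ∃ M : Ω → ℝ, EssBounded μ M ∧ ∫ ω, M ω ∂μ = 0 ∧
      ∀ᵐ ω ∂μ, f ω ≤ 2 * (Φ ω - Φ' ω + M ω + Z ω)) :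
    ∫ ω, f ω ∂μ ≤ 2 * (∫ ω, Φ ω ∂μ - ∫ ω, Φ' ω ∂μ + ∫ ω, Z ω ∂μ) := by
  obtain ⟨M, hM, hM0, hle⟩ := hle
  refine (integral_mono_ae hf.integrable
    ((((hΦ.sub hΦ').add hM).add hZ).const_mul 2).integrable hle).trans_eq ?_
  rw [integral_const_mul, integral_add ((hΦ.sub hΦ').add hM).integrable hZ.integrable,
    integral_add (hΦ.sub hΦ').integrable hM.integrable, integral_sub hΦ.integrable hΦ'.integrable,
    hM0, add_zero]

theorem sum_integral_inv_sq_le (h : MomentumErrorProcess μ ℱ w e n k ρ) {r : ℕ → ℝ}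
    (hr : ∀ t, ∫ ω, w t ω * ‖n (t + 1) ω - k t ω‖ ^ 2 ∂μ ≤ r t) (T : ℕ) :
    ∑ t ∈ Finset.range T, ∫ ω, (w (t + 1) ω ^ 2)⁻¹ * ‖e t ω‖ ^ 2 ∂μ
      ≤ 22 * ρ ^ 5 + 36 * ρ ^ 2 * ∑ t ∈ Finset.range T, r t := by
  have hρ := h.one_le_rho
  have hΦ (t : ℕ) : EssBounded μ fun ω =>
      ‖e t ω‖ ^ 2 + 4 * ρ ^ 5 * (w t ω ^ 2)⁻¹ + 6 * ρ ^ 4 * (w (t + 1) ω)⁻¹ :=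
    (((h.essBounded_e t).norm.pow 2).add ((h.essBounded_inv_w_pow t 2).const_mul _)).add
      ((h.essBounded_inv_w (t + 1)).const_mul _)
  have hstep (t : ℕ) := integral_step_le
    ((h.essBounded_inv_w_pow (t + 1) 2).mul ((h.essBounded_e t).norm.pow 2))
    (hΦ t) (hΦ (t + 1)) ((h.essBounded_w_mul_sq t).const_mul (18 * ρ ^ 2)) (h.step_le t)
  simp only [integral_const_mul] at hstep
  have h0 : ∫ ω, (‖e 0 ω‖ ^ 2 + 4 * ρ ^ 5 * (w 0 ω ^ 2)⁻¹ + 6 * ρ ^ 4 * (w 1 ω)⁻¹) ∂μ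
      ≤ 11 * ρ ^ 5 := by
    have hae : ∀ᵐ ω ∂μ, ‖e 0 ω‖ ^ 2 + 4 * ρ ^ 5 * (w 0 ω ^ 2)⁻¹ + 6 * ρ ^ 4 * (w 1 ω)⁻¹
        ≤ 11 * ρ ^ 5 := by
      filter_upwards [h.norm_n_sq_le 0] with ω h1
      rw [h.e_zero, h.w_zero]
      have h2 : (w 1 ω)⁻¹ ≤ 1 := inv_le_one_of_one_le₀ (h.one_le_w 1 ω)
      have h3 : ρ ^ 3 ≤ ρ ^ 5 := pow_le_pow_right₀ hρ (by norm_num)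
      have h4 : ρ ^ 4 ≤ ρ ^ 5 := pow_le_pow_right₀ hρ (by norm_num)
      have h5 : 6 * ρ ^ 4 * (w 1 ω)⁻¹ ≤ 6 * ρ ^ 4 * 1 := by gcongr
      norm_num
      linarith
    simpa using integral_mono_ae (hΦ 0).integrable (integrable_const (11 * ρ ^ 5)) hae
  have hT : 0 ≤ ∫ ω, (‖e T ω‖ ^ 2 + 4 * ρ ^ 5 * (w T ω ^ 2)⁻¹ + 6 * ρ ^ 4 * (w (T + 1) ω)⁻¹) ∂μ :=
    integral_nonneg fun ω => by
      have := h.w_nonneg T ω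
      have := h.w_nonneg (T + 1) ω
      have : 0 ≤ ρ := by linarith
      positivity
  have htel := Finset.sum_range_sub' (fun t =>
    ∫ ω, (‖e t ω‖ ^ 2 + 4 * ρ ^ 5 * (w t ω ^ 2)⁻¹ + 6 * ρ ^ 4 * (w (t + 1) ω)⁻¹) ∂μ) T
  have hsum := Finset.sum_le_sum fun t (_ : t ∈ Finset.range T) => hstep t
  rw [← Finset.mul_sum, Finset.sum_add_distrib, htel, ← Finset.mul_sum] at hsum
  have hrs : 18 * ρ ^ 2 * ∑ t ∈ Finset.range T, ∫ ω, w t ω * ‖n (t + 1) ω - k t ω‖ ^ 2 ∂μ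
      ≤ 18 * ρ ^ 2 * ∑ t ∈ Finset.range T, r t :=
    mul_le_mul_of_nonneg_left (Finset.sum_le_sum fun t _ => hr t) (by positivity)
  simp only [zero_add] at hsum
  linarith

theorem sum_integral_inv_le (h : MomentumErrorProcess μ ℱ w e n k ρ) {r : ℕ → ℝ}
    (hr : ∀ t, ∫ ω, w t ω * ‖n (t + 1) ω - k t ω‖ ^ 2 ∂μ ≤ r t) (T : ℕ) :
    ∑ t ∈ Finset.range T, ∫ ω, (w (t + 1) ω)⁻¹ * ‖e t ω‖ ^ 2 ∂μ
      ≤ 152 * ρ ^ 8 + 224 * ρ ^ 5 * ∑ t ∈ Finset.range T, r t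
        + 12 * ρ ^ 3 * ∫ ω, Real.log (w (T + 1) ω) ∂μ := by
  have hρ := h.one_le_rho
  have hlog (t : ℕ) : EssBounded μ fun ω => Real.log (w t ω) :=
    (h.essBounded_w t).log_of_one_le (h.one_le_w t)
  have hΦ (t : ℕ) : EssBounded μ fun ω =>
      w t ω * ‖e t ω‖ ^ 2 + 8 * ρ ^ 5 * (w t ω)⁻¹ + 12 * ρ ^ 7 * (w (t + 1) ω)⁻¹
          - 6 * ρ ^ 3 * Real.log (w (t + 1) ω) :=
    ((((h.essBounded_w t).mul ((h.essBounded_e t).norm.pow 2)).add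
      ((h.essBounded_inv_w t).const_mul _)).add ((h.essBounded_inv_w (t + 1)).const_mul _)).sub
      ((hlog (t + 1)).const_mul _)
  have hI (t : ℕ) : EssBounded μ fun ω => (w (t + 1) ω ^ 2)⁻¹ * ‖e t ω‖ ^ 2 :=
    (h.essBounded_inv_w_pow (t + 1) 2).mul ((h.essBounded_e t).norm.pow 2)
  have hstep (t : ℕ) := integral_step_le (h.essBounded_inv_w_mul_sq t) (hΦ t) (hΦ (t + 1))
    (((hI t).const_mul (5 / 2 * ρ ^ 3)).add ((h.essBounded_w_mul_sq t).const_mul (22 * ρ ^ 3)))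
    (h.weighted_step_le t)
  simp only [integral_add ((hI _).const_mul _).integrable
    ((h.essBounded_w_mul_sq _).const_mul _).integrable, integral_const_mul] at hstep
  have h0 : ∫ ω, (w 0 ω * ‖e 0 ω‖ ^ 2 + 8 * ρ ^ 5 * (w 0 ω)⁻¹ + 12 * ρ ^ 7 * (w 1 ω)⁻¹
      - 6 * ρ ^ 3 * Real.log (w 1 ω)) ∂μ ≤ 21 * ρ ^ 7 := by
    have hae : ∀ᵐ ω ∂μ, w 0 ω * ‖e 0 ω‖ ^ 2 + 8 * ρ ^ 5 * (w 0 ω)⁻¹ + 12 * ρ ^ 7 * (w 1 ω)⁻¹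
        - 6 * ρ ^ 3 * Real.log (w 1 ω) ≤ 21 * ρ ^ 7 := by
      filter_upwards [h.norm_n_sq_le 0] with ω h1
      rw [h.e_zero, h.w_zero]
      have h2 : (w 1 ω)⁻¹ ≤ 1 := inv_le_one_of_one_le₀ (h.one_le_w 1 ω)
      have h3 : ρ ^ 3 ≤ ρ ^ 7 := pow_le_pow_right₀ hρ (by norm_num)
      have h4 : ρ ^ 5 ≤ ρ ^ 7 := pow_le_pow_right₀ hρ (by norm_num)
      have h5 : 12 * ρ ^ 7 * (w 1 ω)⁻¹ ≤ 12 * ρ ^ 7 * 1 := by gcongr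
      have h6 : 0 ≤ 6 * ρ ^ 3 * Real.log (w 1 ω) :=
        mul_nonneg (by positivity) (Real.log_nonneg (h.one_le_w 1 ω))
      norm_num
      linarith
    simpa using integral_mono_ae (hΦ 0).integrable (integrable_const (21 * ρ ^ 7)) hae
  -- The logarithm enters the potential with a minus sign, so its final value survives; after
  -- doubling it is the term `12 * ρ ^ 3` of the conclusion.
  have hT : -(6 * ρ ^ 3 * ∫ ω, Real.log (w (T + 1) ω) ∂μ) ≤
      ∫ ω, (w T ω * ‖e T ω‖ ^ 2 + 8 * ρ ^ 5 * (w T ω)⁻¹ + 12 * ρ ^ 7 * (w (T + 1) ω)⁻¹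
        - 6 * ρ ^ 3 * Real.log (w (T + 1) ω)) ∂μ := by
    rw [← integral_const_mul, ← integral_neg]
    refine integral_mono ((hlog (T + 1)).const_mul _).integrable.neg (hΦ T).integrable fun ω => ?_
    have := h.w_nonneg T ω
    have := h.w_nonneg (T + 1) ω
    have : 0 ≤ ρ := by linarith
    have : 0 ≤ w T ω * ‖e T ω‖ ^ 2 + 8 * ρ ^ 5 * (w T ω)⁻¹ + 12 * ρ ^ 7 * (w (T + 1) ω)⁻¹ := by
      positivity
    simp only
    linarith
  have htel := Finset.sum_range_sub' (fun t =>
    ∫ ω, (w t ω * ‖e t ω‖ ^ 2 + 8 * ρ ^ 5 * (w t ω)⁻¹ + 12 * ρ ^ 7 * (w (t + 1) ω)⁻¹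
        - 6 * ρ ^ 3 * Real.log (w (t + 1) ω)) ∂μ) T
  have hsum := Finset.sum_le_sum fun t (_ : t ∈ Finset.range T) => hstep t
  rw [← Finset.mul_sum, Finset.sum_add_distrib, htel, Finset.sum_add_distrib, ← Finset.mul_sum,
    ← Finset.mul_sum] at hsum
  have hrs : 22 * ρ ^ 3 * ∑ t ∈ Finset.range T, ∫ ω, w t ω * ‖n (t + 1) ω - k t ω‖ ^ 2 ∂μ
      ≤ 22 * ρ ^ 3 * ∑ t ∈ Finset.range T, r t :=
    mul_le_mul_of_nonneg_left (Finset.sum_le_sum fun t _ => hr t) (by positivity)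
  -- The cost of the growing weight is paid by the bound with `w⁻²`.
  have hY := mul_le_mul_of_nonneg_left (h.sum_integral_inv_sq_le hr T)
    (show 0 ≤ 5 / 2 * ρ ^ 3 by positivity)
  have hr0 : 0 ≤ ∑ t ∈ Finset.range T, r t := Finset.sum_nonneg fun t _ =>
    (integral_nonneg fun ω => mul_nonneg (h.w_nonneg t ω) (sq_nonneg _)).trans (hr t)
  have e1 : 5 / 2 * ρ ^ 3 * (22 * ρ ^ 5 + 36 * ρ ^ 2 * ∑ t ∈ Finset.range T, r t)
      = 55 * ρ ^ 8 + 90 * ρ ^ 5 * ∑ t ∈ Finset.range T, r t := by ring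
  have p1 : ρ ^ 7 ≤ ρ ^ 8 := pow_le_pow_right₀ hρ (by norm_num)
  have p2 : ρ ^ 3 * ∑ t ∈ Finset.range T, r t ≤ ρ ^ 5 * ∑ t ∈ Finset.range T, r t :=
    mul_le_mul_of_nonneg_right (pow_le_pow_right₀ hρ (by norm_num)) hr0
  simp only [zero_add] at hsum
  linarith

end MomentumErrorProcess

/-! ### Pathwise descent inequalities -/

section Descent

variable {E : Type*} [NormedAddCommGroup E] [InnerProductSpace ℝ E]

/-- Young's inequality is weighted so that the error appears as `w'⁻¹ ‖e‖²`, the quantity controlled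
in expectation; what remains is a multiple of `S⁻¹ ‖d‖²`, which sums to a logarithm. -/
theorem adaptive_descent_step {F : E → ℝ} {G : E → E} {x x' d e : E} {β lam ρ S w w' : ℝ}
    (hdesc : F x' ≤ F x + inner ℝ (G x) (x' - x) + β * ‖x' - x‖ ^ 2)
    (hx : x' = x - (√(S * w))⁻¹ • d) (he : e = d - G x) (hS : 1 ≤ S) (hw : 1 ≤ w) (hw' : 0 < w')
    (hwρ : w' ≤ ρ * w) (hlam : 0 < lam) (hβ : 0 ≤ β) :
    (√(S * w))⁻¹ * ‖d‖ ^ 2 ≤ F x - F x' + lam * (w'⁻¹ * ‖e‖ ^ 2)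
      + (ρ / (4 * lam) + β) * (S⁻¹ * ‖d‖ ^ 2) := by
  have hw0 : 0 < w := by linarith
  have hS0 : 0 < S := by linarith
  set c := (√(S * w))⁻¹ with hc
  have hc0 : 0 < c := by positivity
  have hc2 : c ^ 2 = (S * w)⁻¹ := by rw [hc, inv_pow, Real.sq_sqrt (by positivity)]
  have hxx : x' - x = -(c • d) := by rw [hx]; abel
  have hG : G x = d - e := by rw [he]; abel
  rw [hxx, hG, norm_neg, norm_smul, inner_neg_right, inner_smul_right, inner_sub_left,
    real_inner_self_eq_norm_sq, mul_pow, Real.norm_eq_abs, sq_abs, hc2] at hdesc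
  have hin := real_inner_le_norm e d
  have h1 : (S * w)⁻¹ ≤ S⁻¹ := by
    gcongr; nlinarith
  have h2 : w' * c ^ 2 ≤ ρ * S⁻¹ := by
    rw [hc2, mul_inv]
    calc w' * (S⁻¹ * w⁻¹) ≤ (ρ * w) * (S⁻¹ * w⁻¹) := by gcongr
      _ = ρ * S⁻¹ * (w * w⁻¹) := by ring
      _ = _ := by rw [mul_inv_cancel₀ hw0.ne', mul_one]
  have young : c * (‖e‖ * ‖d‖) ≤ lam * (w'⁻¹ * ‖e‖ ^ 2) + (w' * c ^ 2) / (4 * lam) * ‖d‖ ^ 2 := by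
    have : lam * (w'⁻¹ * ‖e‖ ^ 2) + (w' * c ^ 2) / (4 * lam) * ‖d‖ ^ 2 - c * (‖e‖ * ‖d‖)
        = (lam * w'⁻¹) * (‖e‖ - w' * c / (2 * lam) * ‖d‖) ^ 2 := by
      field_simp; ring
    have h3 : 0 ≤ (lam * w'⁻¹) * (‖e‖ - w' * c / (2 * lam) * ‖d‖) ^ 2 := by positivity
    linarith
  have h3 : (w' * c ^ 2) / (4 * lam) * ‖d‖ ^ 2 ≤ (ρ * S⁻¹) / (4 * lam) * ‖d‖ ^ 2 := by gcongr
  have h4 : β * ((S * w)⁻¹ * ‖d‖ ^ 2) ≤ β * (S⁻¹ * ‖d‖ ^ 2) := by gcongr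
  have h5 : (ρ * S⁻¹) / (4 * lam) * ‖d‖ ^ 2 = ρ / (4 * lam) * (S⁻¹ * ‖d‖ ^ 2) := by ring
  have h6 : c * inner ℝ e d ≤ c * (‖e‖ * ‖d‖) := by gcongr
  linarith

theorem sum_div_partial_sum_le_log (u : ℕ → ℝ) (hu : ∀ t, 0 ≤ u t) (T : ℕ) :
    ∑ t ∈ Finset.range T, (1 + ∑ i ∈ Finset.range (t + 1), u i)⁻¹ * u t
      ≤ Real.log (1 + ∑ i ∈ Finset.range T, u i) := by
  induction T with
  | zero => simp
  | succ T ih =>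
    rw [Finset.sum_range_succ]
    set a := 1 + ∑ i ∈ Finset.range T, u i with ha
    have ha0 : 0 < a := by
      have := Finset.sum_nonneg fun i (_ : i ∈ Finset.range T) => hu i
      linarith
    have hb : 1 + ∑ i ∈ Finset.range (T + 1), u i = a + u T := by
      rw [Finset.sum_range_succ, ha]; ring
    have hb0 : 0 < a + u T := by linarith [hu T]
    rw [hb]
    have h1 := Real.log_le_sub_one_of_pos (x := a / (a + u T)) (by positivity)
    rw [Real.log_div ha0.ne' hb0.ne'] at h1
    have h2 : (a + u T)⁻¹ * u T = 1 - a / (a + u T) := by field_simp; ring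
    linarith

/-- All denominators are at most `√(V * w T)`, where `V` is the left side; hence `V - 1` is at most
`√(V * w T)` times the sum on the right, and one factor `√V` cancels. -/
theorem one_add_sum_le_mul_sq {u w : ℕ → ℝ} (hu : ∀ t, 0 ≤ u t) (hw : ∀ t, 1 ≤ w t)
    (hmono : Monotone w) (T : ℕ) :
    1 + ∑ i ∈ Finset.range T, u i ≤ w T * (1 + ∑ t ∈ Finset.range T,
      (√((1 + ∑ i ∈ Finset.range (t + 1), u i) * w t))⁻¹ * u t) ^ 2 := by
  set V := 1 + ∑ i ∈ Finset.range T, u i with hV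
  set X := ∑ t ∈ Finset.range T, (√((1 + ∑ i ∈ Finset.range (t + 1), u i) * w t))⁻¹ * u t
  have hV1 : 1 ≤ V := by
    have := Finset.sum_nonneg fun i (_ : i ∈ Finset.range T) => hu i
    linarith
  have hwT := hw T
  have hX : (√(V * w T))⁻¹ * (V - 1) ≤ X := by
    rw [show V - 1 = ∑ i ∈ Finset.range T, u i by rw [hV]; ring, Finset.mul_sum]
    refine Finset.sum_le_sum fun t ht => mul_le_mul_of_nonneg_right ?_ (hu t)
    have ht := Finset.mem_range.1 ht
    have h0 : 0 < 1 + ∑ i ∈ Finset.range (t + 1), u i := by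
      have := Finset.sum_nonneg fun i (_ : i ∈ Finset.range (t + 1)) => hu i
      linarith
    have h1 := hw t
    refine inv_anti₀ (by positivity) (Real.sqrt_le_sqrt (mul_le_mul ?_ (hmono ht.le) (by positivity) (by positivity)))
    rw [hV]
    gcongr
    · intro i _ _; exact hu i
    · omega
  have h1 : √V ≤ √(w T) * (1 + X) := by
    rw [Real.sqrt_mul (by positivity), inv_mul_le_iff₀ (by positivity)] at hX
    have hV0 : 1 ≤ √V := Real.one_le_sqrt.2 hV1
    have hw0 : 1 ≤ √(w T) := Real.one_le_sqrt.2 hwT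
    have h2 : √V * √V = V := Real.mul_self_sqrt (by positivity)
    have h3 : √V * √V ≤ √V * (√(w T) * (1 + X)) := by
      have : 1 ≤ √V * √(w T) := one_le_mul_of_one_le_of_one_le hV0 hw0
      nlinarith
    exact le_of_mul_le_mul_left h3 (by linarith)
  calc V = √V ^ 2 := (Real.sq_sqrt (by positivity)).symm
    _ ≤ (√(w T) * (1 + X)) ^ 2 := by gcongr
    _ = _ := by rw [mul_pow, Real.sq_sqrt (by positivity)]

end Descent

/-! ### Jensen's and Hölder's inequalities, and a logarithmic self-bound -/

/-- Jensen's inequality, from the tangent of the logarithm at `c`. -/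
theorem integral_log_le_log {Ω : Type*} [MeasurableSpace Ω] {μ : Measure Ω} [IsProbabilityMeasure μ]
    {f : Ω → ℝ} {c : ℝ} (hf : EssBounded μ f) (h1 : ∀ ω, 1 ≤ f ω) (hc0 : 0 < c)
    (hc : ∫ ω, f ω ∂μ ≤ c) : ∫ ω, Real.log (f ω) ∂μ ≤ Real.log c := by
  have h : ∫ ω, Real.log (f ω) ∂μ ≤ ∫ ω, (c⁻¹ * f ω + (Real.log c - 1)) ∂μ := by
    refine integral_mono (hf.log_of_one_le h1).integrable
      ((hf.const_mul _).add (.const _)).integrable fun ω => ?_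
    have h0 : 0 < f ω := zero_lt_one.trans_le (h1 ω)
    have := Real.log_le_sub_one_of_pos (x := f ω / c) (by positivity)
    rw [Real.log_div h0.ne' hc0.ne'] at this
    simp only
    rw [inv_mul_eq_div]
    linarith
  rw [integral_add (hf.const_mul _).integrable (integrable_const _), integral_const_mul] at h
  have h2 : c⁻¹ * ∫ ω, f ω ∂μ ≤ 1 := by
    rw [inv_mul_le_iff₀ hc0]; linarith
  simp at h
  linarith

/-- Hölder's inequality, obtained by integrating the weighted arithmetic-geometric mean inequality
for `A / a` and `W / v`. -/
theorem integral_rpow_mul_rpow_le {Ω : Type*} [MeasurableSpace Ω] {μ : Measure Ω}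
    [IsProbabilityMeasure μ] {A W : Ω → ℝ} {a v p q : ℝ} (hA : EssBounded μ A)
    (hW : EssBounded μ W) (hA0 : ∀ ω, 0 ≤ A ω) (hW0 : ∀ ω, 0 ≤ W ω) (ha : 0 < a) (hv : 0 < v)
    (hp : 0 ≤ p) (hq : 0 ≤ q) (hpq : p + q = 1)
    (hAa : ∫ ω, A ω ∂μ ≤ a) (hWv : ∫ ω, W ω ∂μ ≤ v) {f : Ω → ℝ} (hf0 : ∀ ω, 0 ≤ f ω)
    (hf : ∀ᵐ ω ∂μ, f ω ≤ A ω ^ p * W ω ^ q) :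
    ∫ ω, f ω ∂μ ≤ a ^ p * v ^ q := by
  have hb : EssBounded μ fun ω => a ^ p * v ^ q * (p * a⁻¹ * A ω + q * v⁻¹ * W ω) :=
    ((hA.const_mul _).add (hW.const_mul _)).const_mul _
  have h : ∫ ω, f ω ∂μ ≤ ∫ ω, a ^ p * v ^ q * (p * a⁻¹ * A ω + q * v⁻¹ * W ω) ∂μ := by
    refine integral_mono_of_nonneg (.of_forall hf0) hb.integrable ?_
    filter_upwards [hf] with ω hω
    refine hω.trans ?_
    have h1 := Real.geom_mean_le_arith_mean2_weighted hp hq (div_nonneg (hA0 ω) ha.le)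
      (div_nonneg (hW0 ω) hv.le) hpq
    rw [Real.div_rpow (hA0 ω) ha.le, Real.div_rpow (hW0 ω) hv.le] at h1
    calc A ω ^ p * W ω ^ q = a ^ p * v ^ q * (A ω ^ p / a ^ p * (W ω ^ q / v ^ q)) := by
          field_simp
      _ ≤ a ^ p * v ^ q * (p * (A ω / a) + q * (W ω / v)) := by gcongr
      _ = _ := by ring
  refine h.trans ?_
  rw [integral_const_mul, integral_add (hA.const_mul _).integrable (hW.const_mul _).integrable,
    integral_const_mul, integral_const_mul]
  refine mul_le_of_le_one_right (by positivity) ?_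
  have h1 : p * a⁻¹ * ∫ ω, A ω ∂μ ≤ p * a⁻¹ * a := by gcongr
  have h2 : q * v⁻¹ * ∫ ω, W ω ∂μ ≤ q * v⁻¹ * v := by gcongr
  rw [inv_mul_cancel_right₀ ha.ne'] at h1
  rw [inv_mul_cancel_right₀ hv.ne'] at h2
  linarith

/-- Solving `v ≤ A + B log v` for `v`. -/
theorem le_of_le_add_mul_log {v A B : ℝ} (hv : 0 < v) (hB : 0 < B) (h : v ≤ A + B * Real.log v) :
    v ≤ 2 * (A + B * Real.log (2 * B)) := by
  -- The tangent at `2 * B` has a slope that makes `B * log v` cost only `v / 2`.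
  have h1 := Real.log_le_sub_one_of_pos (x := v / (2 * B)) (by positivity)
  rw [Real.log_div hv.ne' (by positivity)] at h1
  have h2 : B * Real.log v ≤ B * (Real.log (2 * B) + v / (2 * B)) := by gcongr; linarith
  have h3 : B * (Real.log (2 * B) + v / (2 * B)) = B * Real.log (2 * B) + v / 2 := by field_simp
  linarith

/-! ### Expected sum of squared gradients -/

section AdaptiveDescent

variable {Ω E : Type*} [MeasurableSpace Ω] [NormedAddCommGroup E]
  [InnerProductSpace ℝ E] [MeasurableSpace E] [BorelSpace E] [SecondCountableTopology E]
  {μ : Measure Ω} [IsProbabilityMeasure μ] {ℱ : ℕ → MeasurableSpace Ω}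
  {w : ℕ → Ω → ℝ} {e n k : ℕ → Ω → E}

set_option maxHeartbeats 1000000 in
/-- Adaptive gradient descent along the direction `d`, whose error is a momentum error process. -/
theorem integral_sum_sq_rpow_le {θ β β' Fs Γ : ℝ} (hθ : 1 ≤ θ) (hβ : 0 ≤ β) (hββ : β ≤ β')
    (hβ' : 1 ≤ β') (h : MomentumErrorProcess μ ℱ w e n k (θ ^ 2)) {F : E → ℝ} {G : E → E}
    (hdesc : ∀ x y, F y ≤ F x + inner ℝ (G x) (y - x) + β * ‖y - x‖ ^ 2)
    (hlow : ∀ x, Fs ≤ F x) {x d : ℕ → Ω → E} {x₁ : E} (hx0 : ∀ ω, x 0 ω = x₁)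
    (hx : ∀ t ω, x (t + 1) ω = x t ω -
      (√((1 + ∑ i ∈ Finset.range (t + 1), ‖d i ω‖ ^ 2) * w t ω))⁻¹ • d t ω)
    (he : ∀ t ω, e t ω = d t ω - G (x t ω)) (hd : ∀ t, EssBounded μ (d t))
    (hvar : ∀ t, ∫ ω, w t ω * ‖n (t + 1) ω - k t ω‖ ^ 2 ∂μ ≤
      β ^ 2 * ∫ ω, (1 + ∑ i ∈ Finset.range (t + 1), ‖d i ω‖ ^ 2)⁻¹ * ‖d t ω‖ ^ 2 ∂μ)
    (T : ℕ) (hΓ1 : 1 ≤ Γ) (hΓ : ∫ ω, w (T + 1) ω ^ 3 ∂μ ≤ Γ) :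
    ∃ V : ℝ, 0 < V ∧
      V ≤ 2 * (1 + (F x₁ - Fs) + 241 * (θ ^ 9 * β') * (1 + Real.log Γ)
        + 482 * (θ ^ 9 * β') * Real.log (964 * (θ ^ 9 * β'))) ∧
      ∫ ω, (∑ t ∈ Finset.range T, ‖G (x t ω)‖ ^ 2) ^ (3 / 7 : ℝ) ∂μ ≤
        2 * (Γ ^ (1 / 7 : ℝ) * V ^ (6 / 7 : ℝ)) := by
  have hθ0 : 0 < θ := by linarith
  have hβ'0 : 0 < β' := by linarith
  -- The final bound contains `ρ ^ (9 / 2)`; taking `ρ = θ ^ 2` keeps the exponents integral.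
  set K := θ ^ 9 * β' with hK
  have hK1 : 1 ≤ K := one_le_mul_of_one_le_of_one_le (one_le_pow₀ hθ) hβ'
  set S : ℕ → Ω → ℝ := fun t ω => 1 + ∑ i ∈ Finset.range t, ‖d i ω‖ ^ 2 with hS
  have hS1 (t : ℕ) (ω : Ω) : 1 ≤ S t ω :=
    le_add_of_nonneg_right (Finset.sum_nonneg fun i _ => sq_nonneg _)
  have bd (t : ℕ) : EssBounded μ fun ω => ‖d t ω‖ ^ 2 := (hd t).norm.pow 2
  have bS (t : ℕ) : EssBounded μ (S t) := (EssBounded.const 1).add (.sum _ fun i _ => bd i)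
  have br (t : ℕ) : EssBounded μ fun ω => (S (t + 1) ω)⁻¹ * ‖d t ω‖ ^ 2 :=
    (EssBounded.inv_of_one_le (bS _).measurable (hS1 _)).mul (bd t)
  have bX : EssBounded μ fun ω =>
      ∑ t ∈ Finset.range T, (√(S (t + 1) ω * w t ω))⁻¹ * ‖d t ω‖ ^ 2 := by
    refine .sum _ fun t _ => EssBounded.mul (.inv_of_one_le ?_ fun ω => ?_) (bd t)
    · exact ((bS _).measurable.mul (h.measurable_w t)).sqrt
    · exact Real.one_le_sqrt.2 (one_le_mul_of_one_le_of_one_le (hS1 _ ω) (h.one_le_w t ω))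
  have bY : EssBounded μ fun ω => ∑ t ∈ Finset.range T, (w (t + 1) ω)⁻¹ * ‖e t ω‖ ^ 2 :=
    .sum _ fun t _ => h.essBounded_inv_w_mul_sq t
  have bR : EssBounded μ fun ω => ∑ t ∈ Finset.range T, (S (t + 1) ω)⁻¹ * ‖d t ω‖ ^ 2 :=
    .sum _ fun t _ => br t
  set X : Ω → ℝ := fun ω => ∑ t ∈ Finset.range T, (√(S (t + 1) ω * w t ω))⁻¹ * ‖d t ω‖ ^ 2
  set Y : Ω → ℝ := fun ω => ∑ t ∈ Finset.range T, (w (t + 1) ω)⁻¹ * ‖e t ω‖ ^ 2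
  set R : Ω → ℝ := fun ω => ∑ t ∈ Finset.range T, (S (t + 1) ω)⁻¹ * ‖d t ω‖ ^ 2
  have hX0 (ω : Ω) : 0 ≤ X ω := Finset.sum_nonneg fun t _ => by positivity
  have hY0 (ω : Ω) : 0 ≤ Y ω := Finset.sum_nonneg fun t _ =>
    mul_nonneg (inv_nonneg.2 (h.w_nonneg _ _)) (sq_nonneg _)
  have hRlog (ω : Ω) : R ω ≤ Real.log (S T ω) :=
    sum_div_partial_sum_le_log (fun i => ‖d i ω‖ ^ 2) (fun _ => sq_nonneg _) T
  set ℓ := ∫ ω, Real.log (S T ω) ∂μ with hℓ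
  set lw := ∫ ω, Real.log (w (T + 1) ω) ∂μ with hlw
  have blogS := (bS T).log_of_one_le (hS1 T)
  have blogw (t : ℕ) := (h.essBounded_w t).log_of_one_le (h.one_le_w t)
  have hℓ0 : 0 ≤ ℓ := integral_nonneg fun ω => Real.log_nonneg (hS1 T ω)
  have hlw0 : 0 ≤ lw := integral_nonneg fun ω => Real.log_nonneg (h.one_le_w _ ω)
  have hER0 : 0 ≤ ∫ ω, R ω ∂μ := integral_nonneg fun ω => Finset.sum_nonneg fun t _ =>
    mul_nonneg (inv_nonneg.2 (zero_le_one.trans (hS1 _ ω))) (sq_nonneg _)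
  have hER : ∫ ω, R ω ∂μ ≤ ℓ := integral_mono bR.integrable blogS.integrable hRlog
  -- the error bound
  have hEY : ∫ ω, Y ω ∂μ ≤ 224 * (θ ^ 16 * β' ^ 2) * (1 + ℓ + lw) := by
    have h1 := h.sum_integral_inv_le hvar T
    rw [← integral_finsetSum _ fun t _ => (h.essBounded_inv_w_mul_sq t).integrable,
      ← Finset.mul_sum, ← integral_finsetSum _ fun t _ => (br t).integrable] at h1
    refine h1.trans ?_
    have p1 : (θ ^ 2) ^ 8 * 1 ≤ θ ^ 16 * β' ^ 2 := by
      rw [← pow_mul]; gcongr; exact one_le_pow₀ hβ'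
    have p2 : (θ ^ 2) ^ 5 * (β ^ 2 * ∫ ω, R ω ∂μ) ≤ θ ^ 16 * β' ^ 2 * ℓ := by
      rw [← pow_mul, ← mul_assoc]
      have : θ ^ (2 * 5) ≤ θ ^ 16 := pow_le_pow_right₀ hθ (by norm_num)
      gcongr
    have p3 : (θ ^ 2) ^ 3 * lw ≤ θ ^ 16 * β' ^ 2 * lw := by
      gcongr
      rw [← pow_mul]
      calc θ ^ (2 * 3) ≤ θ ^ 16 * 1 := by
            rw [mul_one]; exact pow_le_pow_right₀ hθ (by norm_num)
        _ ≤ _ := by gcongr; exact one_le_pow₀ hβ'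
    have p0 : 0 ≤ θ ^ 16 * β' ^ 2 * lw := by positivity
    have p4 : 0 ≤ θ ^ 16 * β' ^ 2 := by positivity
    linarith
  -- the descent bound
  have hEX : ∫ ω, X ω ∂μ ≤ (F x₁ - Fs) + 226 * K * (1 + ℓ + lw) := by
    -- This choice balances the two uses of Young's parameter: `lam * (θ ^ 16 * β' ^ 2) = K` and `θ
    -- ^ 2 / (4 * lam) = K / 4`.
    set lam := (θ ^ 7 * β')⁻¹ with hlam
    have hlam0 : 0 < lam := by positivity
    have hae : ∀ᵐ ω ∂μ, X ω ≤ (F x₁ - Fs) + lam * Y ω + (θ ^ 2 / (4 * lam) + β) * R ω := by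
      filter_upwards [ae_all_iff.2 h.w_succ_le] with ω hω
      have hs := Finset.sum_le_sum fun t (_ : t ∈ Finset.range T) =>
        adaptive_descent_step (hdesc (x t ω) (x (t + 1) ω)) (hx t ω) (he t ω) (hS1 (t + 1) ω)
          (h.one_le_w t ω) (zero_lt_one.trans_le (h.one_le_w (t + 1) ω)) (hω t) hlam0 hβ
      rw [Finset.sum_add_distrib, Finset.sum_add_distrib,
        Finset.sum_range_sub' (fun t => F (x t ω)), ← Finset.mul_sum, ← Finset.mul_sum, hx0] at hs
      have := hlow (x T ω)
      refine hs.trans ?_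
      gcongr
    have b1 := (EssBounded.const (μ := μ) (F x₁ - Fs)).add (bY.const_mul lam)
    have b2 := bR.const_mul (θ ^ 2 / (4 * lam) + β)
    have hI := integral_mono_ae bX.integrable (b1.add b2).integrable hae
    rw [integral_add b1.integrable b2.integrable,
      integral_add (integrable_const _) (bY.const_mul lam).integrable, integral_const_mul,
      integral_const_mul] at hI
    simp only [integral_const, probReal_univ, one_smul] at hI
    have q1 : lam * ∫ ω, Y ω ∂μ ≤ 224 * K * (1 + ℓ + lw) := by
      calc lam * ∫ ω, Y ω ∂μ ≤ lam * (224 * (θ ^ 16 * β' ^ 2) * (1 + ℓ + lw)) := by gcongr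
        _ = _ := by rw [hlam, hK]; field_simp
    have q2 : θ ^ 2 / (4 * lam) + β ≤ 2 * K := by
      have : θ ^ 2 / (4 * lam) = K / 4 := by rw [hlam, hK]; field_simp
      have : β' ≤ K := le_mul_of_one_le_left hβ'0.le (one_le_pow₀ hθ)
      linarith
    have q3 : (θ ^ 2 / (4 * lam) + β) * ∫ ω, R ω ∂μ ≤ 2 * K * ℓ := by
      refine mul_le_mul q2 hER hER0 (by positivity)
    have q4 : 0 ≤ K * lw := by positivity
    linarith
  -- the quantity that dominates both
  set q := 1 + ℓ + lw with hq
  have hq1 : 1 ≤ q := by linarith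
  -- Chosen so that the bound on the expectation of `Y` is at most `M ^ 2`, with `15 ^ 2 = 225 ≥
  -- 224`.
  set M := 15 * K * q with hM
  have hM0 : 0 < M := by positivity
  -- The last bracket is an affine majorant of `√Y` with expectation at most `M`, so `W` dominates
  -- both `1 + X` and `√Y` while its expectation stays computable.
  set W : Ω → ℝ := fun ω => 1 + X ω + ((2 * M)⁻¹ * Y ω + M / 2) with hW
  have bW : EssBounded μ W := ((EssBounded.const 1).add bX).add ((bY.const_mul _).add (.const _))
  have hW1 (ω : Ω) : 1 ≤ W ω := by
    have := hX0 ω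
    have : 0 ≤ (2 * M)⁻¹ * Y ω := mul_nonneg (by positivity) (hY0 ω)
    simp only [hW]; linarith
  have hEW : ∫ ω, W ω ∂μ ≤ 1 + (F x₁ - Fs) + 241 * K * q := by
    simp only [hW]
    rw [integral_add ((EssBounded.const 1).add bX).integrable ((bY.const_mul _).add (.const _)).integrable,
      integral_add (integrable_const _) bX.integrable,
      integral_add (bY.const_mul _).integrable (integrable_const _), integral_const_mul]
    simp only [integral_const, probReal_univ, one_smul]
    have hYM : ∫ ω, Y ω ∂μ ≤ M ^ 2 := by
      refine hEY.trans ?_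
      have : θ ^ 16 ≤ θ ^ 18 := pow_le_pow_right₀ hθ (by norm_num)
      calc 224 * (θ ^ 16 * β' ^ 2) * q ≤ 225 * (θ ^ 18 * β' ^ 2) * q ^ 2 := by
            gcongr
            · norm_num
            · exact le_self_pow₀ hq1 two_ne_zero
        _ = M ^ 2 := by rw [hM, hK]; ring
    have hYM' : (2 * M)⁻¹ * ∫ ω, Y ω ∂μ ≤ M / 2 := by
      calc _ ≤ (2 * M)⁻¹ * M ^ 2 := by gcongr
        _ = _ := by field_simp
    linarith
  have hmono (ω : Ω) : Monotone fun t => w t ω := monotone_nat_of_le_succ fun t => h.w_mono t ω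
  have hWsq (ω : Ω) : (1 + X ω) ^ 2 + Y ω ≤ W ω ^ 2 := by
    have h1 : Y ω ≤ ((2 * M)⁻¹ * Y ω + M / 2) ^ 2 := by
      have e1 : ((2 * M)⁻¹ * Y ω + M / 2) ^ 2 - Y ω = ((2 * M)⁻¹ * Y ω - M / 2) ^ 2 := by
        field_simp; ring
      linarith [sq_nonneg ((2 * M)⁻¹ * Y ω - M / 2)]
    have h2 : 0 ≤ (2 * M)⁻¹ * Y ω + M / 2 := by have := hY0 ω; positivity
    have h3 := hX0 ω
    simp only [hW]
    nlinarith [mul_nonneg (show 0 ≤ 1 + X ω by linarith) h2]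
  have hSW (ω : Ω) : S T ω ≤ w T ω * (1 + X ω) ^ 2 :=
    one_add_sum_le_mul_sq (fun _ => sq_nonneg _) (fun t => h.one_le_w t ω) (hmono ω) T
  set V := ∫ ω, W ω ∂μ with hV
  have hV1 : 1 ≤ V := by
    simpa using integral_mono (integrable_const (1 : ℝ)) bW.integrable hW1
  have hlwΓ : lw ≤ 1 / 3 * Real.log Γ := by
    have := integral_log_le_log ((h.essBounded_w (T + 1)).pow 3)
      (fun ω => one_le_pow₀ (h.one_le_w (T + 1) ω)) (by linarith) hΓ
    simp only [Real.log_pow, integral_const_mul] at this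
    push_cast at this
    linarith
  -- This closes the loop: the expectation `V` was bounded through `ℓ`, and `ℓ` is now bounded by
  -- the logarithm of `V`.
  have hℓV : ℓ ≤ lw + 2 * Real.log V := by
    have h1 : ℓ ≤ ∫ ω, (Real.log (w (T + 1) ω) + 2 * Real.log (W ω)) ∂μ := by
      refine integral_mono blogS.integrable
        ((blogw (T + 1)).add ((bW.log_of_one_le hW1).const_mul 2)).integrable fun ω => ?_
      have hw1 := h.one_le_w (T + 1) ω
      have hW1' := hW1 ω
      have h2 : S T ω ≤ w (T + 1) ω * W ω ^ 2 := by
        refine (hSW ω).trans (mul_le_mul (h.w_mono T ω) ?_ (sq_nonneg _) (by linarith))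
        linarith [hWsq ω, hY0 ω]
      have h3 := Real.log_le_log (zero_lt_one.trans_le (hS1 T ω)) h2
      rw [Real.log_mul (by positivity) (by positivity), Real.log_pow] at h3
      exact_mod_cast h3
    rw [integral_add (blogw (T + 1)).integrable ((bW.log_of_one_le hW1).const_mul 2).integrable,
      integral_const_mul] at h1
    linarith [integral_log_le_log bW hW1 (by linarith) hV.ge]
  refine ⟨V, by linarith, ?_, ?_⟩
  · have hlogV : V ≤ (1 + (F x₁ - Fs) + 241 * K * (1 + Real.log Γ)) + 482 * K * Real.log V := by
      have : q ≤ 1 + Real.log Γ + 2 * Real.log V := by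
        have := Real.log_nonneg hΓ1
        linarith
      calc V ≤ 1 + (F x₁ - Fs) + 241 * K * q := hEW
        _ ≤ 1 + (F x₁ - Fs) + 241 * K * (1 + Real.log Γ + 2 * Real.log V) := by gcongr
        _ = _ := by ring
    have := le_of_le_add_mul_log (by linarith) (by positivity) hlogV
    rwa [show 2 * (482 * K) = 964 * K by ring] at this
  -- Pathwise, `∑ ‖d‖² ≤ w (1 + X)²` and `∑ ‖e‖² ≤ w Y`, so the gradients sum to at most `2 w W²`;
  -- the factor `2⁻¹` absorbs `2 ^ (3 / 7)`.
  · have hpt (ω : Ω) : 2⁻¹ * (∑ t ∈ Finset.range T, ‖G (x t ω)‖ ^ 2) ^ (3 / 7 : ℝ) ≤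
        (w T ω ^ 3) ^ (1 / 7 : ℝ) * W ω ^ (6 / 7 : ℝ) := by
      have hw0 := h.w_nonneg T ω
      have hW0 : 0 ≤ W ω := zero_le_one.trans (hW1 ω)
      have hsum : ∑ t ∈ Finset.range T, ‖G (x t ω)‖ ^ 2 ≤ 2 * (w T ω * W ω ^ 2) := by
        have h1 : ∀ t ∈ Finset.range T,
            ‖G (x t ω)‖ ^ 2 ≤ 2 * ‖d t ω‖ ^ 2 + 2 * (w T ω * ((w (t + 1) ω)⁻¹ * ‖e t ω‖ ^ 2)) := by
          intro t ht
          have hG : G (x t ω) = d t ω - e t ω := by rw [he]; abel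
          have h2 : ‖G (x t ω)‖ ^ 2 ≤ (‖d t ω‖ + ‖e t ω‖) ^ 2 := by
            rw [hG]; gcongr; exact norm_sub_le _ _
          have h3 : 1 ≤ w T ω * (w (t + 1) ω)⁻¹ := by
            rw [← div_eq_mul_inv, one_le_div (zero_lt_one.trans_le (h.one_le_w _ ω))]
            exact hmono ω (Finset.mem_range.1 ht)
          have h4 := mul_le_mul_of_nonneg_right h3 (sq_nonneg ‖e t ω‖)
          nlinarith [sq_nonneg (‖d t ω‖ - ‖e t ω‖)]
        have h5 := Finset.sum_le_sum h1
        rw [Finset.sum_add_distrib, ← Finset.mul_sum, ← Finset.mul_sum, ← Finset.mul_sum] at h5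
        have h6 := mul_le_mul_of_nonneg_left (hWsq ω) hw0
        have h7 := hSW ω
        simp only [hS] at h7
        change _ ≤ 2 * ∑ i ∈ Finset.range T, ‖d i ω‖ ^ 2 + 2 * (w T ω * Y ω) at h5
        linarith
      have h8 : (∑ t ∈ Finset.range T, ‖G (x t ω)‖ ^ 2) ^ (3 / 7 : ℝ)
          ≤ (2 * (w T ω * W ω ^ 2)) ^ (3 / 7 : ℝ) :=
        Real.rpow_le_rpow (Finset.sum_nonneg fun _ _ => sq_nonneg _) hsum (by norm_num)
      have h9 : (2 : ℝ) ^ (3 / 7 : ℝ) ≤ 2 := by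
        simpa using Real.rpow_le_rpow_of_exponent_le (x := 2) one_le_two (show (3 / 7 : ℝ) ≤ 1 by norm_num)
      rw [Real.mul_rpow (by norm_num) (by positivity), Real.mul_rpow hw0 (by positivity)] at h8
      have e1 : w T ω ^ (3 / 7 : ℝ) = (w T ω ^ 3) ^ (1 / 7 : ℝ) := by
        rw [← Real.rpow_natCast, ← Real.rpow_mul hw0]; norm_num
      have e2 : (W ω ^ 2) ^ (3 / 7 : ℝ) = W ω ^ (6 / 7 : ℝ) := by
        rw [← Real.rpow_natCast, ← Real.rpow_mul hW0]; norm_num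
      rw [e1, e2] at h8
      have h10 : 0 ≤ (w T ω ^ 3) ^ (1 / 7 : ℝ) * W ω ^ (6 / 7 : ℝ) := by positivity
      linarith [mul_le_mul_of_nonneg_right h9 h10]
    have hw3 : ∫ ω, w T ω ^ 3 ∂μ ≤ Γ := by
      refine le_trans ?_ hΓ
      refine integral_mono ((h.essBounded_w T).pow 3).integrable
        ((h.essBounded_w (T + 1)).pow 3).integrable fun ω => ?_
      exact pow_le_pow_left₀ (h.w_nonneg T ω) (h.w_mono T ω) 3
    have hfin := integral_rpow_mul_rpow_le (p := 1 / 7) (q := 6 / 7) ((h.essBounded_w T).pow 3) bW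
      (fun ω => pow_nonneg (h.w_nonneg T ω) 3) (fun ω => zero_le_one.trans (hW1 ω))
      (by linarith) (by linarith) (by norm_num) (by norm_num) (by norm_num) hw3 hV.ge
      (fun ω => by positivity) (.of_forall hpt)
    rw [integral_const_mul] at hfin
    linarith

end AdaptiveDescent

/-! ### Gradient oracles: consequences of unbiasedness and averaged smoothness -/

/-- The hypotheses on a stochastic gradient oracle `g` for the gradient field `G`. -/
structure IsGradientOracle {E Ξ : Type*} [NormedAddCommGroup E] [InnerProductSpace ℝ E]
    [MeasurableSpace E] [MeasurableSpace Ξ] (D : Measure Ξ) (g : E → Ξ → E) (G : E → E)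
    (σ σ' β : ℝ) : Prop where
  measurable : Measurable fun z : E × Ξ => g z.1 z.2
  measurable_mean : Measurable G
  integrable : ∀ x, Integrable (g x) D
  unbiased : ∀ x, ∫ s, g x s ∂D = G x
  noise_le : ∀ x, ∀ᵐ s ∂D, ‖g x s - G x‖ ≤ 2 * σ'
  variance_le : ∀ x, ∫ s, ‖g x s - G x‖ ^ 2 ∂D ≤ σ ^ 2
  integrable_sq : ∀ x y, Integrable (fun s => ‖g x s - g y s‖ ^ 2) D
  smooth : ∀ x y, ∫ s, ‖g x s - g y s‖ ^ 2 ∂D ≤ β ^ 2 * ‖x - y‖ ^ 2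


section Variance

variable {Ξ E : Type*} [MeasurableSpace Ξ] {D : Measure Ξ} [IsProbabilityMeasure D]
  [NormedAddCommGroup E] [InnerProductSpace ℝ E] [CompleteSpace E]

theorem integral_norm_sub_integral_sq {Z : Ξ → E} (hZ : Integrable Z D)
    (hZ2 : Integrable (fun s => ‖Z s‖ ^ 2) D) :
    ∫ s, ‖Z s - ∫ r, Z r ∂D‖ ^ 2 ∂D = ∫ s, ‖Z s‖ ^ 2 ∂D - ‖∫ r, Z r ∂D‖ ^ 2 := by
  set m := ∫ r, Z r ∂D with hm
  have hi : Integrable (fun s => inner ℝ m (Z s)) D := hZ.const_inner m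
  have e : ∀ s, ‖Z s - m‖ ^ 2 = ‖Z s‖ ^ 2 - 2 * inner ℝ m (Z s) + ‖m‖ ^ 2 := fun s => by
    rw [norm_sub_sq_real, real_inner_comm]
  have hi2 : Integrable (fun s => ‖Z s‖ ^ 2 - 2 * inner ℝ m (Z s)) D := hZ2.sub (hi.const_mul 2)
  simp only [e]
  rw [integral_add hi2 (integrable_const _), integral_sub hZ2 (hi.const_mul 2),
    integral_const_mul, integral_inner hZ, ← hm, real_inner_self_eq_norm_sq]
  simp
  ring

end Variance

namespace IsGradientOracle

variable {E Ξ : Type*} [NormedAddCommGroup E] [InnerProductSpace ℝ E] [CompleteSpace E]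
    [MeasurableSpace E] [MeasurableSpace Ξ] {D : Measure Ξ} [IsProbabilityMeasure D]
    {g : E → Ξ → E} {G : E → E} {σ σ' β : ℝ}

theorem integral_sub (h : IsGradientOracle D g G σ σ' β) (x y : E) :
    ∫ s, (g x s - g y s) ∂D = G x - G y := by
  rw [MeasureTheory.integral_sub (h.integrable x) (h.integrable y), h.unbiased, h.unbiased]

/-- Centring does not increase the second moment. -/
theorem integral_noise_sub_sq_le (h : IsGradientOracle D g G σ σ' β) (x y : E) :
    ∫ s, ‖(g x s - G x) - (g y s - G y)‖ ^ 2 ∂D ≤ β ^ 2 * ‖x - y‖ ^ 2 := by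
  have h1 := integral_norm_sub_integral_sq ((h.integrable x).sub (h.integrable y))
    (h.integrable_sq x y)
  simp only [Pi.sub_apply, h.integral_sub] at h1
  have e : ∀ s, (g x s - G x) - (g y s - G y) = g x s - g y s - (G x - G y) := fun s => by abel
  simp only [e, h1]
  linarith [h.smooth x y, sq_nonneg ‖G x - G y‖]

/-- The same variance identity, now dropping the variance: the squared norm of a mean is at most the
second moment. -/
theorem norm_mean_sub_le (h : IsGradientOracle D g G σ σ' β) (hβ : 0 ≤ β) (x y : E) :
    ‖G x - G y‖ ≤ β * ‖x - y‖ := by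
  have h1 := integral_norm_sub_integral_sq ((h.integrable x).sub (h.integrable y))
    (h.integrable_sq x y)
  simp only [Pi.sub_apply, h.integral_sub] at h1
  have h2 : 0 ≤ ∫ s, ‖g x s - g y s - (G x - G y)‖ ^ 2 ∂D := integral_nonneg fun s => sq_nonneg _
  refine le_of_sq_le_sq ?_ (by positivity)
  rw [mul_pow]
  linarith [h.smooth x y]

theorem integral_inner_noise (h : IsGradientOracle D g G σ σ' β) (v x : E) :
    ∫ s, inner ℝ v (g x s - G x) ∂D = 0 := by
  have hi : Integrable (fun s => g x s - G x) D := (h.integrable x).sub (integrable_const _)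
  rw [integral_inner hi, MeasureTheory.integral_sub (h.integrable x) (integrable_const _), h.unbiased]
  simp

end IsGradientOracle

/-! ### The iterates of the algorithm as a momentum error process -/

section Iterates

variable {E Ξ Ω : Type*} [NormedAddCommGroup E] [InnerProductSpace ℝ E]

/-- The state of META-STORM with `p = 1/2`, `q = 1/4` and `a₀ = b₀ = η = 1` after `t` iterations,
along the random sample sequence `ξ`. -/
noncomputable abbrev stormState (g : E → Ξ → E) (x₁ : E) (ξ : ℕ → Ω → Ξ) (t : ℕ) (ω : Ω) : MetaStormState E :=
  metaStorm ⟨1, 1, 1, 1 / 2, 1 / 4⟩ g x₁ (fun i => ξ i ω) (t + 1)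

variable {g : E → Ξ → E} {x₁ : E} {ξ : ℕ → Ω → Ξ} {G : E → E}

/-- The cube root of `1 + ∑ ‖g (x i) (ξ i) - g (x i) (ξ (i + 1))‖²`. -/
noncomputable def stormWeight (g : E → Ξ → E) (x₁ : E) (ξ : ℕ → Ω → Ξ) (t : ℕ) (ω : Ω) : ℝ :=
  (1 + (stormState g x₁ ξ t ω).sumG) ^ (1 / 3 : ℝ)

theorem stormState_sumG_nonneg (t : ℕ) (ω : Ω) : 0 ≤ (stormState g x₁ ξ t ω).sumG := by
  induction t with
  | zero => exact le_rfl
  | succ t ih => exact add_nonneg ih (by positivity)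

theorem stormState_sumD (t : ℕ) (ω : Ω) : (stormState g x₁ ξ t ω).sumD =
    ∑ i ∈ Finset.range (t + 1), ‖(stormState g x₁ ξ i ω).d‖ ^ 2 := by
  induction t with
  | zero => simp [stormState, metaStorm, metaStormInit]
  | succ t ih => rw [Finset.sum_range_succ, ← ih]; rfl

theorem stormWeight_nonneg (t : ℕ) (ω : Ω) : 0 ≤ stormWeight g x₁ ξ t ω :=
  Real.rpow_nonneg (by linarith [stormState_sumG_nonneg (g := g) (x₁ := x₁) (ξ := ξ) t ω]) _

theorem stormWeight_cube (t : ℕ) (ω : Ω) :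
    stormWeight g x₁ ξ t ω ^ 3 = 1 + (stormState g x₁ ξ t ω).sumG := by
  have := stormState_sumG_nonneg (g := g) (x₁ := x₁) (ξ := ξ) t ω
  rw [stormWeight, ← Real.rpow_natCast, ← Real.rpow_mul (by linarith)]
  norm_num

theorem stormState_sumG_succ (t : ℕ) (ω : Ω) : (stormState g x₁ ξ (t + 1) ω).sumG =
    (stormState g x₁ ξ t ω).sumG + ‖g (stormState g x₁ ξ t ω).x (ξ (t + 1) ω) -
      g (stormState g x₁ ξ t ω).x (ξ (t + 2) ω)‖ ^ 2 := by
  have : (stormState g x₁ ξ (t + 1) ω).sumG =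
    (stormState g x₁ ξ t ω).sumG + ‖g (stormState g x₁ ξ t ω).x (ξ (t + 1) ω) -
      g (stormState g x₁ ξ t ω).x (ξ (t + 2) ω)‖ ^ 2 / 1 ^ 2 := rfl
  rw [this, one_pow, div_one]

theorem stormState_a (t : ℕ) (ω : Ω) :
    (stormState g x₁ ξ t ω).a = (stormWeight g x₁ ξ t ω ^ 2)⁻¹ := by
  have := stormState_sumG_nonneg (g := g) (x₁ := x₁) (ξ := ξ) t ω
  rw [MetaStormState.a, stormWeight, ← Real.rpow_natCast, ← Real.rpow_mul (by linarith),
    ← Real.rpow_neg (by linarith)]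
  norm_num

theorem stormState_b (t : ℕ) (ω : Ω) :
    (stormState g x₁ ξ t ω).b ⟨1, 1, 1, 1 / 2, 1 / 4⟩ =
      √((1 + ∑ i ∈ Finset.range (t + 1), ‖(stormState g x₁ ξ i ω).d‖ ^ 2) *
        stormWeight g x₁ ξ t ω) := by
  have hG := stormState_sumG_nonneg (g := g) (x₁ := x₁) (ξ := ξ) t ω
  have hS : 0 ≤ ∑ i ∈ Finset.range (t + 1), ‖(stormState g x₁ ξ i ω).d‖ ^ 2 :=
    Finset.sum_nonneg fun _ _ => sq_nonneg _
  have hA : 0 < 1 + (stormState g x₁ ξ t ω).sumG := by linarith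
  rw [MetaStormState.b, MetaStormState.a, stormState_sumD, stormWeight,
    Real.sqrt_mul (by linarith), Real.sqrt_eq_rpow, Real.sqrt_eq_rpow, ← Real.rpow_mul hA.le,
    ← Real.rpow_mul hA.le, Real.one_rpow, div_eq_mul_inv, ← Real.rpow_neg hA.le]
  norm_num

theorem stormState_x_succ (t : ℕ) (ω : Ω) : (stormState g x₁ ξ (t + 1) ω).x =
    (stormState g x₁ ξ t ω).x - (√((1 + ∑ i ∈ Finset.range (t + 1),
      ‖(stormState g x₁ ξ i ω).d‖ ^ 2) * stormWeight g x₁ ξ t ω))⁻¹ • (stormState g x₁ ξ t ω).d := by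
  rw [← stormState_b, inv_eq_one_div]
  exact metaStorm_x_succ _ _ _ _ _ (by omega)

theorem stormState_d_succ (t : ℕ) (ω : Ω) : (stormState g x₁ ξ (t + 1) ω).d =
    g (stormState g x₁ ξ (t + 1) ω).x (ξ (t + 2) ω) +
      (1 - (stormWeight g x₁ ξ (t + 1) ω ^ 2)⁻¹) • ((stormState g x₁ ξ t ω).d -
        g (stormState g x₁ ξ t ω).x (ξ (t + 2) ω)) := by
  rw [stormState, metaStorm_d_succ _ _ _ _ _ (by omega), ← stormState_a]

variable [MeasurableSpace E] [BorelSpace E] [SecondCountableTopology E] [MeasurableSpace Ξ]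

/-- State `t` is the algorithm's state at time `t + 1`, hence determined by the samples up to index
`t + 1`. The iterate of the next state needs no further sample; this is what makes the noise there
centred. The induction is strong because the step size involves all earlier directions. -/
theorem measurable_stormState (hg : Measurable fun z : E × Ξ => g z.1 z.2) (t : ℕ) :
    Measurable[sampleHistory ξ t] (fun ω => (stormState g x₁ ξ t ω).x) ∧
    Measurable[sampleHistory ξ t] (fun ω => (stormState g x₁ ξ t ω).d) ∧
    Measurable[sampleHistory ξ t] (fun ω => (stormState g x₁ ξ t ω).sumG) ∧
    Measurable[sampleHistory ξ t] (fun ω => (stormState g x₁ ξ (t + 1) ω).x) := by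
  have hw (t : ℕ) (h : Measurable[sampleHistory ξ t] (fun ω => (stormState g x₁ ξ t ω).sumG)) :
      Measurable[sampleHistory ξ t] (stormWeight g x₁ ξ t) :=
    (measurable_const.add h).pow_const _
  have hg' (t : ℕ) {y : Ω → E} {s : Ω → Ξ} (hy : Measurable[sampleHistory ξ t] y)
      (hs : Measurable[sampleHistory ξ t] s) : Measurable[sampleHistory ξ t] fun ω => g (y ω) (s ω) :=
    hg.comp (hy.prodMk hs)
  induction t using Nat.strong_induction_on with
  | _ t ih =>
    have key : Measurable[sampleHistory ξ t] (fun ω => (stormState g x₁ ξ t ω).x) ∧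
        Measurable[sampleHistory ξ t] (fun ω => (stormState g x₁ ξ t ω).d) ∧
        Measurable[sampleHistory ξ t] (fun ω => (stormState g x₁ ξ t ω).sumG) := by
      rcases t with _ | t
      · exact ⟨measurable_const, hg' 0 measurable_const (measurable_sample_of_le le_rfl),
          measurable_const⟩
      · obtain ⟨h1, h2, h3, h4⟩ := ih t (by omega)
        have hle := sampleHistory_mono (ξ := ξ) (Nat.le_succ t)
        have h1 := h1.mono hle le_rfl
        have h2 := h2.mono hle le_rfl
        have h3 := h3.mono hle le_rfl
        have h4 := h4.mono hle le_rfl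
        have s1 : Measurable[sampleHistory ξ (t + 1)] (ξ (t + 1)) := measurable_sample_of_le (by omega)
        have s2 : Measurable[sampleHistory ξ (t + 1)] (ξ (t + 2)) := measurable_sample_of_le (by omega)
        have hG : Measurable[sampleHistory ξ (t + 1)] (fun ω => (stormState g x₁ ξ (t + 1) ω).sumG) := by
          simp only [stormState_sumG_succ]
          exact h3.add ((measurable_norm.comp ((hg' _ h1 s1).sub (hg' _ h1 s2))).pow_const 2)
        refine ⟨h4, ?_, hG⟩
        simp only [stormState_d_succ]
        exact (hg' _ h4 s2).add
          ((measurable_const.sub ((hw _ hG).pow_const 2).inv).smul (h2.sub (hg' _ h1 s2)))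
    refine ⟨key.1, key.2.1, key.2.2, ?_⟩
    simp only [stormState_x_succ]
    refine key.1.sub (Measurable.smul (Measurable.inv (Measurable.sqrt (Measurable.mul
      (measurable_const.add (Finset.measurable_fun_sum _ fun i hi => ?_)) (hw t key.2.2)))) key.2.1)
    rcases (Nat.lt_succ_iff.1 (Finset.mem_range.1 hi)).eq_or_lt with rfl | hlt
    · exact (measurable_norm.comp key.2.1).pow_const 2
    · exact (measurable_norm.comp ((ih i hlt).2.1.mono (sampleHistory_mono hlt.le) le_rfl)).pow_const 2

theorem measurable_stormState_x [MeasurableSpace Ω] (hg : Measurable fun z : E × Ξ => g z.1 z.2)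
    (hξ : ∀ t, Measurable (ξ t)) (t : ℕ) : Measurable fun ω => (stormState g x₁ ξ t ω).x :=
  (measurable_stormState hg t).1.mono (sampleHistory_le hξ t) le_rfl

variable [MeasurableSpace Ω] {μ : Measure Ω} [IsProbabilityMeasure μ] {D : Measure Ξ}
  [IsProbabilityMeasure D] [CompleteSpace E] {σ σ' β : ℝ}

theorem stormState_momentumErrorProcess (h : IsGradientOracle D g G σ σ' β)
    (hξ : ∀ t, Measurable (ξ t)) (hlaw : ∀ t, μ.map (ξ t) = D) (hind : iIndepFun ξ μ)
    {ρ : ℝ} (hρ : 1 ≤ ρ) (hρσ : ρ ^ 3 = 1 + 16 * σ' ^ 2) :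
    MomentumErrorProcess μ (sampleHistory ξ) (stormWeight g x₁ ξ)
      (fun t ω => (stormState g x₁ ξ t ω).d - G (stormState g x₁ ξ t ω).x)
      (fun t ω => g (stormState g x₁ ξ t ω).x (ξ (t + 1) ω) - G (stormState g x₁ ξ t ω).x)
      (fun t ω => g (stormState g x₁ ξ t ω).x (ξ (t + 2) ω) - G (stormState g x₁ ξ t ω).x) ρ := by
  have hm := measurable_stormState (x₁ := x₁) (ξ := ξ) h.measurable
  have hle := sampleHistory_le hξ
  have hw (t : ℕ) : Measurable[sampleHistory ξ t] (stormWeight g x₁ ξ t) :=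
    (measurable_const.add (hm t).2.2.1).pow_const _
  have hGx (t : ℕ) : Measurable[sampleHistory ξ t] fun ω => G (stormState g x₁ ξ t ω).x :=
    h.measurable_mean.comp (hm t).1
  have hn (t : ℕ) : Measurable[sampleHistory ξ t] fun ω =>
      g (stormState g x₁ ξ t ω).x (ξ (t + 1) ω) - G (stormState g x₁ ξ t ω).x :=
    (h.measurable.comp ((hm t).1.prodMk (measurable_sample_of_le le_rfl))).sub (hGx t)
  have hk (t : ℕ) : Measurable fun ω =>
      g (stormState g x₁ ξ t ω).x (ξ (t + 2) ω) - G (stormState g x₁ ξ t ω).x :=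
    (h.measurable.comp (((hm t).1.mono (hle t) le_rfl).prodMk (hξ _))).sub
      ((hGx t).mono (hle t) le_rfl)
  have hnoise : Measurable fun z : E × Ξ => g z.1 z.2 - G z.1 :=
    h.measurable.sub (h.measurable_mean.comp measurable_fst)
  -- The noise is at most `2 * σ'`, and `4 * (2 * σ') ^ 2 = 16 * σ' ^ 2`.
  have hsq {v : E} (hv : ‖v‖ ≤ 2 * σ') : 4 * ‖v‖ ^ 2 ≤ ρ ^ 3 - 1 := by
    rw [hρσ]; nlinarith [norm_nonneg v]
  have hmp : MeasurableSet {z : E × Ξ | ‖g z.1 z.2 - G z.1‖ ≤ 2 * σ'} :=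
    measurableSet_le hnoise.norm measurable_const
  have hinner : Measurable fun z : (E × E) × Ξ => inner ℝ z.1.1 (g z.1.2 z.2 - G z.1.2) :=
    (measurable_fst.comp measurable_fst).inner
      (hnoise.comp ((measurable_snd.comp measurable_fst).prodMk measurable_snd))
  exact
  { one_le_rho := hρ
    w_zero := fun ω => by simp [stormWeight, stormState, metaStorm, metaStormInit]
    w_nonneg := stormWeight_nonneg
    w_succ := fun t ω => by
      rw [stormWeight_cube, stormWeight_cube, stormState_sumG_succ, sub_sub_sub_cancel_right, add_assoc]
    e_zero := fun ω => rfl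
    e_succ := fun t ω => by
      rw [stormState_d_succ]; module
    measurable_n := fun t => (hn t).mono (hle t) le_rfl
    measurable_k := hk
    measurable_e := fun t => ((hm t).2.1.sub (hGx t)).mono (hle t) le_rfl
    measurable_w := fun t => (hw t).mono (hle t) le_rfl
    norm_n := fun t => by
      rcases t with _ | t
      · have h1 := h.noise_le x₁
        rw [← hlaw 1] at h1
        filter_upwards [ae_of_ae_map (hξ 1).aemeasurable h1] with ω hω using hsq hω
      · filter_upwards [ae_sample_of_forall_ae hξ hlaw hind (hm t).2.2.2 hmp h.noise_le] with ω hω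
          using hsq hω
    norm_k := fun t => by
      filter_upwards [ae_sample_of_forall_ae hξ hlaw hind (hm t).1 hmp h.noise_le] with ω hω
        using hsq hω
    adapted_w := hw
    adapted_e := fun t => (hm t).2.1.sub (hGx t)
    adapted_n := hn
    integral_inner_n := fun t v hv =>
      integral_sample_eq_zero hξ hlaw hind (hv.prodMk (hm t).2.2.2) hinner
        fun y => h.integral_inner_noise y.1 y.2
    integral_inner_k := fun t v hv =>
      integral_sample_eq_zero hξ hlaw hind (hv.prodMk (hm t).1) hinner
        fun y => h.integral_inner_noise y.1 y.2 }

/-- Each step has length at most one because `‖d‖²` is itself a summand of `S`. -/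
theorem norm_stormState_step_le (t : ℕ) (ω : Ω) (hw : 1 ≤ stormWeight g x₁ ξ t ω) :
    ‖(stormState g x₁ ξ (t + 1) ω).x - (stormState g x₁ ξ t ω).x‖ ^ 2 =
      (stormWeight g x₁ ξ t ω)⁻¹ * ((1 + ∑ i ∈ Finset.range (t + 1),
        ‖(stormState g x₁ ξ i ω).d‖ ^ 2)⁻¹ * ‖(stormState g x₁ ξ t ω).d‖ ^ 2) ∧
    ‖(stormState g x₁ ξ (t + 1) ω).x - (stormState g x₁ ξ t ω).x‖ ≤ 1 := by
  set S := 1 + ∑ i ∈ Finset.range (t + 1), ‖(stormState g x₁ ξ i ω).d‖ ^ 2 with hS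
  have hdS : ‖(stormState g x₁ ξ t ω).d‖ ^ 2 ≤ S := by
    rw [hS, Finset.sum_range_succ]
    have := Finset.sum_nonneg fun i (_ : i ∈ Finset.range t) => sq_nonneg ‖(stormState g x₁ ξ i ω).d‖
    linarith
  have hS0 : 0 < S := by
    have := Finset.sum_nonneg fun i (_ : i ∈ Finset.range (t + 1)) =>
      sq_nonneg ‖(stormState g x₁ ξ i ω).d‖
    linarith
  have e : ‖(stormState g x₁ ξ (t + 1) ω).x - (stormState g x₁ ξ t ω).x‖ ^ 2 =
      (stormWeight g x₁ ξ t ω)⁻¹ * (S⁻¹ * ‖(stormState g x₁ ξ t ω).d‖ ^ 2) := by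
    rw [stormState_x_succ, ← hS, sub_sub_cancel_left, norm_neg, norm_smul, mul_pow, norm_inv,
      Real.norm_eq_abs, abs_of_nonneg (Real.sqrt_nonneg _), inv_pow, Real.sq_sqrt (by positivity),
      mul_inv]
    ring
  refine ⟨e, le_of_sq_le_sq ?_ zero_le_one⟩
  rw [e, one_pow]
  refine mul_le_one₀ (inv_le_one_of_one_le₀ hw) (by positivity) ?_
  rw [inv_mul_le_iff₀ hS0, mul_one]
  exact hdS

section Moments

variable {ρ : ℝ}

/-- A qualitative bound, depending on `t`: steps have length at most one and `G` is Lipschitz. Only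
integrability is drawn from it. -/
theorem essBounded_gradient_stormState (h : IsGradientOracle D g G σ σ' β) (hβ : 0 ≤ β)
    (hξ : ∀ t, Measurable (ξ t)) (hlaw : ∀ t, μ.map (ξ t) = D) (hind : iIndepFun ξ μ)
    (hρ : 1 ≤ ρ) (hρσ : ρ ^ 3 = 1 + 16 * σ' ^ 2) (t : ℕ) :
    EssBounded μ fun ω => G (stormState g x₁ ξ t ω).x := by
  have hp := stormState_momentumErrorProcess (x₁ := x₁) h hξ hlaw hind hρ hρσ
  have hdist (ω : Ω) : ‖(stormState g x₁ ξ t ω).x - x₁‖ ≤ t := by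
    induction t with
    | zero => simp [stormState, metaStorm, metaStormInit]
    | succ t ih =>
      have h1 := (norm_stormState_step_le t ω (hp.one_le_w t ω)).2
      have h2 := norm_add_le ((stormState g x₁ ξ (t + 1) ω).x - (stormState g x₁ ξ t ω).x)
        ((stormState g x₁ ξ t ω).x - x₁)
      rw [sub_add_sub_cancel] at h2
      push_cast
      linarith
  refine ⟨h.measurable_mean.comp (measurable_stormState_x h.measurable hξ t),
    β * t + ‖G x₁‖, .of_forall fun ω => ?_⟩
  have h1 := norm_add_le (G (stormState g x₁ ξ t ω).x - G x₁) (G x₁)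
  rw [sub_add_cancel] at h1
  have h2 := h.norm_mean_sub_le hβ (stormState g x₁ ξ t ω).x x₁
  have h3 := mul_le_mul_of_nonneg_left (hdist ω) hβ
  linarith

theorem essBounded_stormState_d (h : IsGradientOracle D g G σ σ' β) (hβ : 0 ≤ β)
    (hξ : ∀ t, Measurable (ξ t)) (hlaw : ∀ t, μ.map (ξ t) = D) (hind : iIndepFun ξ μ)
    (hρ : 1 ≤ ρ) (hρσ : ρ ^ 3 = 1 + 16 * σ' ^ 2) (t : ℕ) :
    EssBounded μ fun ω => (stormState g x₁ ξ t ω).d := by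
  have hp := stormState_momentumErrorProcess (x₁ := x₁) h hξ hlaw hind hρ hρσ
  simpa using (hp.essBounded_e t).add (essBounded_gradient_stormState (x₁ := x₁) h hβ hξ hlaw hind hρ hρσ t)

/-- The weight cancels the factor `w⁻¹` in the squared step length, so averaged smoothness leaves
exactly the terms that sum to `log S`. -/
theorem integral_weighted_noise_sub_sq_le (h : IsGradientOracle D g G σ σ' β) (hβ : 0 ≤ β)
    (hξ : ∀ t, Measurable (ξ t)) (hlaw : ∀ t, μ.map (ξ t) = D) (hind : iIndepFun ξ μ)
    (hρ : 1 ≤ ρ) (hρσ : ρ ^ 3 = 1 + 16 * σ' ^ 2) (t : ℕ) :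
    ∫ ω, stormWeight g x₁ ξ t ω *
      ‖(g (stormState g x₁ ξ (t + 1) ω).x (ξ (t + 2) ω) - G (stormState g x₁ ξ (t + 1) ω).x) -
        (g (stormState g x₁ ξ t ω).x (ξ (t + 2) ω) - G (stormState g x₁ ξ t ω).x)‖ ^ 2 ∂μ ≤
    β ^ 2 * ∫ ω, (1 + ∑ i ∈ Finset.range (t + 1),
        ‖(stormState g x₁ ξ i ω).d‖ ^ 2)⁻¹ * ‖(stormState g x₁ ξ t ω).d‖ ^ 2 ∂μ := by
  have hp := stormState_momentumErrorProcess (x₁ := x₁) h hξ hlaw hind hρ hρσ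
  have hm := measurable_stormState (x₁ := x₁) (ξ := ξ) h.measurable t
  have hd := essBounded_stormState_d (x₁ := x₁) h hβ hξ hlaw hind hρ hρσ
  have hY : Measurable[sampleHistory ξ t] fun ω =>
      (stormWeight g x₁ ξ t ω, (stormState g x₁ ξ (t + 1) ω).x, (stormState g x₁ ξ t ω).x) :=
    (hp.adapted_w t).prodMk (hm.2.2.2.prodMk hm.1)
  have hnoise : Measurable fun z : E × Ξ => g z.1 z.2 - G z.1 :=
    h.measurable.sub (h.measurable_mean.comp measurable_fst)
  -- The absolute value changes nothing along the process, but makes the conditional bound valid for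
  -- every real value of the weight.
  have hfun : Measurable fun z : (ℝ × E × E) × Ξ =>
      |z.1.1| * ‖(g z.1.2.1 z.2 - G z.1.2.1) - (g z.1.2.2 z.2 - G z.1.2.2)‖ ^ 2 := by
    have m1 : Measurable fun z : (ℝ × E × E) × Ξ => (z.1.2.1, z.2) := by fun_prop
    have m2 : Measurable fun z : (ℝ × E × E) × Ξ => (z.1.2.2, z.2) := by fun_prop
    have m3 : Measurable fun z : (ℝ × E × E) × Ξ => |z.1.1| := by fun_prop
    exact m3.mul (((hnoise.comp m1).sub (hnoise.comp m2)).norm.pow_const 2)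
  have hc : Measurable fun y : ℝ × E × E => |y.1| * (β ^ 2 * ‖y.2.1 - y.2.2‖ ^ 2) := by fun_prop
  have eL (ω : Ω) : |stormWeight g x₁ ξ t ω| = stormWeight g x₁ ξ t ω :=
    abs_of_nonneg (stormWeight_nonneg t ω)
  have eR (ω : Ω) : |stormWeight g x₁ ξ t ω| *
      (β ^ 2 * ‖(stormState g x₁ ξ (t + 1) ω).x - (stormState g x₁ ξ t ω).x‖ ^ 2) =
      β ^ 2 * ((1 + ∑ i ∈ Finset.range (t + 1),
        ‖(stormState g x₁ ξ i ω).d‖ ^ 2)⁻¹ * ‖(stormState g x₁ ξ t ω).d‖ ^ 2) := by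
    have h1 := hp.one_le_w t ω
    rw [eL, (norm_stormState_step_le t ω h1).1]
    field_simp
  have bR : EssBounded μ fun ω => β ^ 2 * ((1 + ∑ i ∈ Finset.range (t + 1),
        ‖(stormState g x₁ ξ i ω).d‖ ^ 2)⁻¹ * ‖(stormState g x₁ ξ t ω).d‖ ^ 2) :=
    (EssBounded.mul (.inv_of_one_le
      ((EssBounded.const 1).add (.sum _ fun i _ => (hd i).norm.pow 2)).measurable
      fun ω => le_add_of_nonneg_right (Finset.sum_nonneg fun i _ => sq_nonneg _))
      ((hd t).norm.pow 2)).const_mul _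
  have key := integral_sample_le hξ hlaw hind hY hfun hc (fun y => by
      simp only [integral_const_mul]
      exact mul_le_mul_of_nonneg_left (h.integral_noise_sub_sq_le y.2.1 y.2.2) (abs_nonneg _))
    (by simpa only [eL] using (hp.essBounded_w_mul_sq t).integrable)
    (by simpa only [eR] using bR.integrable)
  simp only [eR, integral_const_mul] at key
  simpa only [eL] using key

/-- Each increment `‖n - k‖²` is at most `2‖n‖² + 2‖k‖²`, and both noises have variance at most `σ ^
2`. -/
theorem integral_stormWeight_cube_le (h : IsGradientOracle D g G σ σ' β)
    (hξ : ∀ t, Measurable (ξ t)) (hlaw : ∀ t, μ.map (ξ t) = D) (hind : iIndepFun ξ μ)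
    (hρ : 1 ≤ ρ) (hρσ : ρ ^ 3 = 1 + 16 * σ' ^ 2) (t : ℕ) :
    ∫ ω, stormWeight g x₁ ξ t ω ^ 3 ∂μ ≤ 1 + 4 * σ ^ 2 * t := by
  have hp := stormState_momentumErrorProcess (x₁ := x₁) h hξ hlaw hind hρ hρσ
  have hm := measurable_stormState (x₁ := x₁) (ξ := ξ) h.measurable
  have hsq : Measurable fun z : E × Ξ => ‖g z.1 z.2 - G z.1‖ ^ 2 :=
    (h.measurable.sub (h.measurable_mean.comp measurable_fst)).norm.pow_const 2
  have hn (t : ℕ) : ∫ ω, ‖g (stormState g x₁ ξ t ω).x (ξ (t + 1) ω) -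
      G (stormState g x₁ ξ t ω).x‖ ^ 2 ∂μ ≤ σ ^ 2 := by
    rcases t with _ | t
    · have h1 := h.variance_le x₁
      have hsq1 : Measurable fun s => ‖g x₁ s - G x₁‖ ^ 2 :=
        hsq.comp (measurable_const.prodMk measurable_id)
      rwa [← hlaw 1, integral_map (hξ 1).aemeasurable hsq1.aestronglyMeasurable] at h1
    · have := integral_sample_le hξ hlaw hind (hm t).2.2.2 hsq measurable_const
        (c := fun _ => σ ^ 2) h.variance_le ((hp.essBounded_n (t + 1)).norm.pow 2).integrable
        (integrable_const _)
      simpa using this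
  have hk (t : ℕ) : ∫ ω, ‖g (stormState g x₁ ξ t ω).x (ξ (t + 2) ω) -
      G (stormState g x₁ ξ t ω).x‖ ^ 2 ∂μ ≤ σ ^ 2 := by
    have := integral_sample_le hξ hlaw hind (hm t).1 hsq measurable_const
      (c := fun _ => σ ^ 2) h.variance_le ((hp.essBounded_k t).norm.pow 2).integrable
      (integrable_const _)
    simpa using this
  induction t with
  | zero => simp [hp.w_zero]
  | succ t ih =>
    have b1 := (hp.essBounded_w t).pow 3
    have b2 := ((hp.essBounded_n t).norm.pow 2).const_mul 2
    have b3 := ((hp.essBounded_k t).norm.pow 2).const_mul 2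
    have h1 := integral_mono ((hp.essBounded_w (t + 1)).pow 3).integrable
      (b1.add (b2.add b3)).integrable fun ω => by
        rw [hp.w_succ]
        have h2 := norm_sub_le (g (stormState g x₁ ξ t ω).x (ξ (t + 1) ω) - G (stormState g x₁ ξ t ω).x)
          (g (stormState g x₁ ξ t ω).x (ξ (t + 2) ω) - G (stormState g x₁ ξ t ω).x)
        have h3 := pow_le_pow_left₀ (norm_nonneg _) h2 2
        refine add_le_add_right (h3.trans ?_) _
        exact (add_sq_le).trans_eq (mul_add _ _ _)
    rw [integral_add b1.integrable (b2.add b3).integrable, integral_add b2.integrable b3.integrable,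
      integral_const_mul, integral_const_mul] at h1
    have := hn t
    have := hk t
    push_cast
    linarith

end Moments

end Iterates

/-! ### Numerical estimates for the final bound -/

section FinalEstimate

/-- Both sides are squared; the constant comes from `17 ^ 3 = 4913 ≤ 71 ^ 2`. -/
theorem one_add_sq_rpow_le {s θ : ℝ} (hs : 0 ≤ s) (h : θ ^ 6 = 1 + 16 * s ^ 2) :
    θ ^ 9 ≤ 71 * (1 + s ^ 3) := by
  have hs3 : 0 ≤ s ^ 3 := by positivity
  refine le_of_sq_le_sq ?_ (by positivity)
  have e : (θ ^ 9) ^ 2 = (1 + 16 * s ^ 2) ^ 3 := by rw [← h]; ring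
  rw [e]
  rcases le_total s 1 with h1 | h1
  · have : s ^ 2 ≤ 1 := pow_le_one₀ hs h1
    calc (1 + 16 * s ^ 2) ^ 3 ≤ (1 + 16 * 1) ^ 3 := by gcongr
      _ ≤ (71 * (1 + 0)) ^ 2 := by norm_num
      _ ≤ _ := by gcongr
  · have : 1 ≤ s ^ 2 := one_le_pow₀ h1
    calc (1 + 16 * s ^ 2) ^ 3 ≤ (s ^ 2 + 16 * s ^ 2) ^ 3 := by gcongr
      _ = 4913 * (s ^ 3) ^ 2 := by ring
      _ ≤ _ := by nlinarith

theorem log_one_add_eight_mul_le {y : ℝ} (hy : 0 ≤ y) :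
    Real.log (1 + 8 * y) ≤ 8 * Real.log (1 + y) := by
  have h : 1 + 8 * y ≤ (1 + y) ^ 8 := by
    simpa using one_add_mul_le_pow (show -2 ≤ y by linarith) 8
  have := Real.log_le_log (by positivity) h
  rwa [Real.log_pow, Nat.cast_ofNat] at this

theorem add_three_rpow_le {a b c p : ℝ} (ha : 0 ≤ a) (hb : 0 ≤ b) (hc : 0 ≤ c) (hp : 0 ≤ p)
    (hp1 : p ≤ 1) : (a + b + c) ^ p ≤ a ^ p + b ^ p + c ^ p :=
  (Real.rpow_add_le_add_rpow (add_nonneg ha hb) hc hp hp1).trans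
    (add_le_add_left (Real.rpow_add_le_add_rpow ha hb hp hp1) _)

theorem rpow_mul_le_boundQ {Δ σ σ' β θ y V : ℝ} (hΔ : 0 ≤ Δ) (hσ : 0 ≤ σ) (hσ' : 0 ≤ σ')
    (hβ : 2 ≤ β) (hθ : θ ^ 6 = 1 + 16 * σ' ^ 2) (hy : 0 ≤ y) (hV0 : 0 ≤ V)
    (hθ1 : 1 ≤ θ)
    (hV : V ≤ 2 * (1 + Δ + 241 * (θ ^ 9 * β) * (1 + Real.log (1 + 8 * y))
        + 482 * (θ ^ 9 * β) * Real.log (964 * (θ ^ 9 * β)))) :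
    V ^ (6 / 7 : ℝ) ≤ 1300438 * (boundQ₁ Δ σ σ' β + boundQ₂ σ' β * Real.log (1 + y) ^ (6 / 7 : ℝ)) := by
  set κ := (1 + σ' ^ 3) * β with hκ
  have hκ2 : 2 ≤ κ := hβ.trans (le_mul_of_one_le_left (by linarith) (by
    have : 0 ≤ σ' ^ 3 := by positivity
    linarith))
  set l := Real.log κ with hl
  have hlog2 : Real.log 2 ≤ l := Real.log_le_log (by norm_num) hκ2
  have hl2 : 0.5 ≤ l := by have := Real.log_two_gt_d9; linarith
  set L := Real.log (1 + y) with hL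
  have hL0 : 0 ≤ L := Real.log_nonneg (by linarith)
  have hK : θ ^ 9 * β ≤ 71 * κ := by
    rw [hκ, ← mul_assoc]
    exact mul_le_mul_of_nonneg_right (one_add_sq_rpow_le hσ' hθ) (by linarith)
  have hK0 : 1 ≤ θ ^ 9 * β := one_le_mul_of_one_le_of_one_le (one_le_pow₀ hθ1) (by linarith)
  have hlogK : Real.log (964 * (θ ^ 9 * β)) ≤ 18 * l := by
    have h1 : 964 * (θ ^ 9 * β) ≤ 2 ^ 17 * κ := by linarith
    have h2 := Real.log_le_log (by positivity) h1
    rw [Real.log_mul (x := 2 ^ 17) (by positivity) (by positivity), Real.log_pow] at h2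
    push_cast at h2
    linarith
  have hlogK0 : 0 ≤ Real.log (964 * (θ ^ 9 * β)) := Real.log_nonneg (by linarith)
  have hΓ := log_one_add_eight_mul_le hy
  have hΓ0 : 0 ≤ Real.log (1 + 8 * y) := Real.log_nonneg (by linarith)
  have b1 : (θ ^ 9 * β) * (1 + Real.log (1 + 8 * y)) ≤ 71 * κ * (1 + 8 * L) := by gcongr
  have b2 : (θ ^ 9 * β) * Real.log (964 * (θ ^ 9 * β)) ≤ 71 * κ * (18 * l) := by gcongr
  have hκl : κ ≤ 2 * (κ * l) := by nlinarith
  have hκL : 0 ≤ κ * L := by positivity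
  -- The coefficient of `κ * l` dominates: `1300438 = 2 * 482 * 71 * 18 + 4 * 241 * 71 + 2`, where
  -- the last two summands come from `κ ≤ 2 * (κ * l)` and `1 ≤ κ * l`.
  have hV' : V ≤ 1300438 * (Δ + κ * l + κ * L) := by linarith
  have hκl0 : 0 ≤ κ * l := by positivity
  have hκpow : κ ^ (6 / 7 : ℝ) ≤ boundQ₂ σ' β := by
    rw [boundQ₂, hκ, Real.mul_rpow (by positivity) (by linarith)]
    gcongr
    refine (Real.rpow_add_le_add_rpow zero_le_one (by positivity) (by norm_num) (by norm_num)).trans_eq ?_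
    rw [Real.one_rpow, ← Real.rpow_natCast, ← Real.rpow_mul hσ']
    norm_num
  have hQ : Δ ^ (6 / 7 : ℝ) + boundQ₂ σ' β * l ^ (6 / 7 : ℝ) ≤ boundQ₁ Δ σ σ' β := by
    have e : β + σ' ^ 3 * β = κ := by rw [hκ]; ring
    rw [boundQ₁, e, ← hl, boundQ₂]
    have : 0 ≤ (σ' * σ) ^ (6 / 7 : ℝ) + σ ^ (12 / 7 : ℝ) + σ' ^ (18 / 7 : ℝ) := by positivity
    linarith
  have hc : (1300438 : ℝ) ^ (6 / 7 : ℝ) ≤ 1300438 := by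
    simpa using Real.rpow_le_rpow_of_exponent_le (x := 1300438) (by norm_num)
      (show (6 / 7 : ℝ) ≤ 1 by norm_num)
  calc V ^ (6 / 7 : ℝ) ≤ (1300438 * (Δ + κ * l + κ * L)) ^ (6 / 7 : ℝ) :=
        Real.rpow_le_rpow hV0 hV' (by norm_num)
    _ = 1300438 ^ (6 / 7 : ℝ) * (Δ + κ * l + κ * L) ^ (6 / 7 : ℝ) :=
        Real.mul_rpow (by norm_num) (by positivity)
    _ ≤ 1300438 * (Δ ^ (6 / 7 : ℝ) + (κ * l) ^ (6 / 7 : ℝ) + (κ * L) ^ (6 / 7 : ℝ)) := by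
        gcongr
        exact add_three_rpow_le hΔ hκl0 hκL (by norm_num) (by norm_num)
    _ ≤ 1300438 * (Δ ^ (6 / 7 : ℝ) + boundQ₂ σ' β * l ^ (6 / 7 : ℝ) + boundQ₂ σ' β * L ^ (6 / 7 : ℝ)) := by
        rw [Real.mul_rpow (by positivity) (by positivity), Real.mul_rpow (by positivity) hL0]
        gcongr
    _ ≤ _ := by gcongr

theorem rate_le {σ : ℝ} (hσ : 0 ≤ σ) {T : ℝ} (hT : 0 < T) :
    1 / T ^ (3 / 7 : ℝ) * (1 + 8 * (σ ^ 2 * T)) ^ (1 / 7 : ℝ) ≤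
      2 * (1 / T ^ (3 / 7 : ℝ) + σ ^ (2 / 7 : ℝ) / T ^ (2 / 7 : ℝ)) := by
  have h1 : (1 + 8 * (σ ^ 2 * T)) ^ (1 / 7 : ℝ) ≤ 1 + 2 * (σ ^ (2 / 7 : ℝ) * T ^ (1 / 7 : ℝ)) := by
    refine (Real.rpow_add_le_add_rpow zero_le_one (by positivity) (by norm_num) (by norm_num)).trans ?_
    rw [Real.one_rpow, Real.mul_rpow (by norm_num) (by positivity),
      Real.mul_rpow (by positivity) hT.le, ← Real.rpow_natCast σ 2, ← Real.rpow_mul hσ]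
    have h8 : (8 : ℝ) ^ (1 / 7 : ℝ) ≤ 2 := by
      have : (8 : ℝ) ^ (1 / 7 : ℝ) ≤ 8 ^ (1 / 3 : ℝ) :=
        Real.rpow_le_rpow_of_exponent_le (by norm_num) (by norm_num)
      refine this.trans_eq ?_
      rw [show (8 : ℝ) = 2 ^ (3 : ℝ) by norm_num, ← Real.rpow_mul (by norm_num)]
      norm_num
    rw [show ((2 : ℕ) : ℝ) * (1 / 7) = 2 / 7 by norm_num]
    gcongr
  have h2 : 1 / T ^ (3 / 7 : ℝ) * (σ ^ (2 / 7 : ℝ) * T ^ (1 / 7 : ℝ))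
      = σ ^ (2 / 7 : ℝ) / T ^ (2 / 7 : ℝ) := by
    rw [show (3 / 7 : ℝ) = 1 / 7 + 2 / 7 by norm_num, Real.rpow_add hT]
    field_simp
  have h3 : 0 < T ^ (3 / 7 : ℝ) := by positivity
  calc _ ≤ 1 / T ^ (3 / 7 : ℝ) * (1 + 2 * (σ ^ (2 / 7 : ℝ) * T ^ (1 / 7 : ℝ))) := by gcongr
    _ = 1 / T ^ (3 / 7 : ℝ) + 2 * (σ ^ (2 / 7 : ℝ) / T ^ (2 / 7 : ℝ)) := by rw [← h2]; ring
    _ ≤ _ := by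
      have : 0 < 1 / T ^ (3 / 7 : ℝ) := by positivity
      linarith

/-- Jensen's inequality for the concave power, with uniform weights. -/
theorem sum_rpow_le_mean {u : ℕ → ℝ} (hu : ∀ t, 0 ≤ u t) {T : ℕ} (hT : 1 ≤ T) {p : ℝ}
    (hp : 0 ≤ p) (hp1 : p ≤ 1) :
    (T : ℝ)⁻¹ * ∑ t ∈ Finset.range T, u t ^ p ≤
      1 / (T : ℝ) ^ p * (∑ t ∈ Finset.range T, u t) ^ p := by
  have hT0 : (0 : ℝ) < T := by exact_mod_cast hT
  have h := (Real.concaveOn_rpow hp hp1).le_map_sum (t := Finset.range T)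
    (w := fun _ => (T : ℝ)⁻¹) (p := u) (fun _ _ => by positivity)
    (by simp [hT0.ne']) (fun t _ => hu t)
  simp only [smul_eq_mul, ← Finset.mul_sum] at h
  refine h.trans_eq ?_
  rw [Real.mul_rpow (by positivity) (Finset.sum_nonneg fun t _ => hu t), Real.inv_rpow hT0.le, one_div]

end FinalEstimate

/-! ### The random output index -/

section RandomIndex

variable {Ω Ξ : Type*} [MeasurableSpace Ω] [MeasurableSpace Ξ] {μ : Measure Ω}
  [IsProbabilityMeasure μ]

theorem uniformOn_Icc_singleton {T t : ℕ} (ht : t ∈ Finset.Icc 1 T) :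
    (uniformOn (Set.Icc 1 T) : Measure ℕ).real {t} = (T : ℝ)⁻¹ := by
  have ht' : t ∈ Set.Icc 1 T := by simpa using ht
  have h1 : Measure.count (Set.Icc 1 T) = (T : ENNReal) := by
    have := Measure.count_apply_finset (Finset.Icc 1 T)
    simpa using this
  rw [uniformOn, measureReal_def, cond_apply measurableSet_Icc,
    Set.inter_eq_self_of_subset_right (by simpa using ht'), Measure.count_singleton, h1, mul_one]
  simp

/-- Evaluating a process at an independent index that is uniform on `{1, …, T}`. -/
theorem integral_uniform_index {S : Type*} [MeasurableSpace S] {T : ℕ} {τ : Ω → ℕ}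
    (hτ : Measurable τ)
    (hτu : μ.map τ = uniformOn (Set.Icc 1 T)) {Z : Ω → S}
    (hind : IndepFun τ Z μ) {H : ℕ → S → ℝ} (hH : ∀ t, Measurable (H t))
    (hHb : ∀ t ∈ Finset.Icc 1 T, EssBounded μ fun ω => H t (Z ω)) :
    Integrable (fun ω => H (τ ω) (Z ω)) μ ∧
    ∫ ω, H (τ ω) (Z ω) ∂μ = (T : ℝ)⁻¹ * ∑ t ∈ Finset.Icc 1 T, ∫ ω, H t (Z ω) ∂μ := by
  have bind (t : ℕ) : EssBounded μ fun ω => if τ ω = t then (1 : ℝ) else 0 :=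
    ⟨Measurable.ite (hτ (measurableSet_singleton t)) measurable_const measurable_const, 1,
      .of_forall fun ω => by
        change ‖if τ ω = t then (1 : ℝ) else 0‖ ≤ 1
        split_ifs <;> simp⟩
  have hτmem : ∀ᵐ ω ∂μ, τ ω ∈ Finset.Icc 1 T := by
    have h1 : ∀ᵐ t ∂(μ.map τ), t ∈ Set.Icc 1 T := by
      rw [hτu, uniformOn]
      exact ae_cond_mem measurableSet_Icc
    filter_upwards [ae_of_ae_map hτ.aemeasurable h1] with ω hω
    simpa using hω
  -- Splitting over the values of the index reduces the claim to products of an indicator and a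
  -- function of `Z`, where independence applies.
  have heq : (fun ω => H (τ ω) (Z ω)) =ᵐ[μ]
      fun ω => ∑ t ∈ Finset.Icc 1 T, (if τ ω = t then (1 : ℝ) else 0) * H t (Z ω) := by
    filter_upwards [hτmem] with ω hω
    simp only [ite_mul, one_mul, zero_mul]
    rw [Finset.sum_ite_eq, if_pos hω]
  have bprod (t : ℕ) (ht : t ∈ Finset.Icc 1 T) := (bind t).mul (hHb t ht)
  refine ⟨(integrable_congr heq).2 (integrable_finsetSum _ fun t ht => (bprod t ht).integrable), ?_⟩
  rw [integral_congr_ae heq, integral_finsetSum _ fun t ht => (bprod t ht).integrable, Finset.mul_sum]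
  refine Finset.sum_congr rfl fun t ht => ?_
  have hm : Measurable fun s : ℕ => if s = t then (1 : ℝ) else 0 := measurable_from_top
  have hi : IndepFun (fun ω => if τ ω = t then (1 : ℝ) else 0) (fun ω => H t (Z ω)) μ :=
    hind.comp hm (hH t)
  rw [hi.integral_fun_mul_eq_mul_integral (bind t).measurable.aestronglyMeasurable
    (hHb t ht).measurable.aestronglyMeasurable]
  congr 1
  have e : (fun ω => if τ ω = t then (1 : ℝ) else 0) = (τ ⁻¹' {t}).indicator 1 := by
    ext ω; by_cases h : τ ω = t <;> simp [h]
  rw [e, integral_indicator_one (hτ (measurableSet_singleton t)),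
    ← map_measureReal_apply hτ (measurableSet_singleton t), hτu, uniformOn_Icc_singleton ht]

end RandomIndex

theorem EssBounded.rpow_const {Ω : Type*} [MeasurableSpace Ω] {μ : Measure Ω} {f : Ω → ℝ}
    (hf : EssBounded μ f) {p : ℝ} (hp : 0 ≤ p) : EssBounded μ fun ω => f ω ^ p := by
  obtain ⟨hf, C, hC⟩ := hf
  refine ⟨hf.pow_const p, C ^ p, ?_⟩
  filter_upwards [hC] with ω hω
  exact (Real.abs_rpow_le_abs_rpow _ _).trans (Real.rpow_le_rpow (abs_nonneg _) hω hp)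

/-! ### Smoothness of the objective and the main theorem -/

section Smooth

variable {E : Type*} [NormedAddCommGroup E] [InnerProductSpace ℝ E] [CompleteSpace E]

/-- The mean value inequality on the segment, applied to `F` minus its linearization at `x`. It
gives `β` in place of the sharp `β / 2`, which affects only the absolute constant. -/
theorem le_add_inner_gradient_add_sq {F : E → ℝ} {β : ℝ} (hβ : 0 ≤ β) (hF : Differentiable ℝ F)
    (hG : ∀ x y, ‖gradient F x - gradient F y‖ ≤ β * ‖x - y‖) (x y : E) :
    F y ≤ F x + inner ℝ (gradient F x) (y - x) + β * ‖y - x‖ ^ 2 := by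
  have h := (convex_segment x y).norm_image_sub_le_of_norm_hasFDerivWithin_le' (f := F)
    (f' := fun z => InnerProductSpace.toDual ℝ E (gradient F z))
    (φ := InnerProductSpace.toDual ℝ E (gradient F x)) (C := β * ‖y - x‖)
    (fun z _ => (hF z).hasGradientAt.hasFDerivAt.hasFDerivWithinAt) (fun z hz => by
      rw [← map_sub, LinearIsometryEquiv.norm_map]
      refine (hG z x).trans (mul_le_mul_of_nonneg_left ?_ hβ)
      obtain ⟨a, b, ha, hb, hab, rfl⟩ := hz
      have e : a • x + b • y - x = b • (y - x) := by
        rw [show a = 1 - b by linarith]; module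
      rw [e, norm_smul, Real.norm_eq_abs, abs_of_nonneg hb]
      exact mul_le_of_le_one_left (norm_nonneg _) (by linarith))
    (left_mem_segment ℝ x y) (right_mem_segment ℝ x y)
  rw [InnerProductSpace.toDual_apply_apply, Real.norm_eq_abs] at h
  have := (abs_le.1 h).2
  nlinarith

end Smooth

theorem isGradientOracle_stochGrad {d : ℕ} {Ξ : Type*} [MeasurableSpace Ξ] {D : Measure Ξ}
    [IsProbabilityMeasure D] {f : EuclideanSpace ℝ (Fin d) → Ξ → ℝ} {σ σ' β : ℝ}
    (hP : IsStochasticProblem D f) (hU : UnbiasedBoundedVariance D f σ)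
    (hS : AveragedSmooth D f β) (hB : BoundedGradDifferences D f σ') :
    IsGradientOracle D (stochGrad f) (gradient (objective D f)) σ σ' β where
  measurable := hP.measurable_grad
  measurable_mean := by
    have h : StronglyMeasurable fun x => ∫ s, stochGrad f x s ∂D :=
      hP.measurable_grad.stronglyMeasurable.integral_prod_right
    simpa only [hU.unbiased] using h.measurable
  integrable := hU.integrable
  unbiased := hU.unbiased
  noise_le := fun x => by
    filter_upwards [hB x] with s hs
    -- By unbiasedness the noise is the average of the gradient differences over an independent
    -- second sample, so it inherits the bound `2 * σ'`.
    have e : stochGrad f x s - gradient (objective D f) x =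
        ∫ r, (stochGrad f x s - stochGrad f x r) ∂D := by
      rw [integral_sub (integrable_const _) (hU.integrable x), hU.unbiased]
      simp
    rw [e]
    simpa using norm_integral_le_of_norm_le_const hs
  variance_le := hU.variance_le
  integrable_sq := hS.integrable_sq
  smooth := hS.smooth

/-- META-STORM with `p = 1/2`, `q = 1/4` and `a₀ = b₀ = η = 1`: there is an absolute constant `C`
such that for every problem that satisfies the assumptions, every number `T ≥ 1` of iterations,
every i.i.d. sample sequence `ξ 1, ξ 2, …` with law `D`, and every output index `τ` that is uniform
on `{1, …, T}` and independent of the samples, the stated bound holds. -/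
theorem theorem3 :
    ∃ C : ℝ, 0 < C ∧
      ∀ (d : ℕ) (Ξ : Type*) [MeasurableSpace Ξ] (D : Measure Ξ) [IsProbabilityMeasure D]
        (f : EuclideanSpace ℝ (Fin d) → Ξ → ℝ) (σ σ' β : ℝ)
        (_ : 0 ≤ σ) (_ : 0 ≤ σ') (_ : 0 ≤ β)
        (_ : IsStochasticProblem D f)
        (_ : LowerBounded D f)
        (_ : UnbiasedBoundedVariance D f σ)
        (_ : AveragedSmooth D f β)
        (_ : BoundedGradDifferences D f σ')
        (x₁ : EuclideanSpace ℝ (Fin d)) (T : ℕ) (_ : 1 ≤ T)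
        (Ω : Type*) [MeasurableSpace Ω] (μ : Measure Ω) [IsProbabilityMeasure μ]
        (ξ : ℕ → Ω → Ξ) (_ : ∀ t, Measurable (ξ t)) (_ : ∀ t, μ.map (ξ t) = D)
        (_ : iIndepFun ξ μ)
        (τ : Ω → ℕ) (_ : Measurable τ) (_ : μ.map τ = uniformOn (Set.Icc 1 T))
        (_ : IndepFun τ (fun ω t => ξ t ω) μ)
        (xout : Ω → EuclideanSpace ℝ (Fin d))
        (_ : ∀ ω, xout ω =
          (metaStorm ⟨1, 1, 1, 1 / 2, 1 / 4⟩ (stochGrad f) x₁ (fun t => ξ t ω) (τ ω)).x),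
        Integrable (fun ω => ‖gradient (objective D f) (xout ω)‖ ^ (6 / 7 : ℝ)) μ ∧
        ∫ ω, ‖gradient (objective D f) (xout ω)‖ ^ (6 / 7 : ℝ) ∂μ ≤
          C * ((boundQ₁ (objective D f x₁ - ⨅ x, objective D f x) σ σ' (max β 2) +
              boundQ₂ σ' (max β 2) * Real.log (1 + σ ^ 2 * T) ^ (6 / 7 : ℝ)) *
            (1 / (T : ℝ) ^ (3 / 7 : ℝ) + σ ^ (2 / 7 : ℝ) / (T : ℝ) ^ (2 / 7 : ℝ))) := by
  -- One factor `2` comes from the bound on the gradient sum, the other from `rate_le`.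
  refine ⟨4 * 1300438, by norm_num, ?_⟩
  intro d Ξ _ D _ f σ σ' β hσ hσ' hβ hP hL hU hS hB x₁ T hT Ω _ μ _ ξ hξ hlaw hind τ hτ hτu hτi
    xout hxout
  have hO := isGradientOracle_stochGrad hP hU hS hB
  set F := objective D f
  set G := gradient F
  set g := stochGrad f
  -- the constants
  set θ : ℝ := (1 + 16 * σ' ^ 2) ^ (1 / 6 : ℝ) with hθdef
  have hθ1 : 1 ≤ θ := Real.one_le_rpow (by nlinarith) (by norm_num)
  have hθ6 : θ ^ 6 = 1 + 16 * σ' ^ 2 := by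
    rw [hθdef, ← Real.rpow_natCast, ← Real.rpow_mul (by positivity)]
    norm_num
  have hρ1 : 1 ≤ θ ^ 2 := one_le_pow₀ hθ1
  have hρ3 : (θ ^ 2) ^ 3 = 1 + 16 * σ' ^ 2 := by rw [← hθ6]; ring
  have hT1 : (1 : ℝ) ≤ T := by exact_mod_cast hT
  have hy : 0 ≤ σ ^ 2 * T := by positivity
  -- the bound for the sum of the squared gradients
  have hproc := stormState_momentumErrorProcess (x₁ := x₁) hO hξ hlaw hind hρ1 hρ3
  obtain ⟨V, hV0, hV, hint⟩ := integral_sum_sq_rpow_le hθ1 hβ (le_max_left β 2)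
    (one_le_two.trans (le_max_right β 2)) hproc
    (le_add_inner_gradient_add_sq hβ hP.differentiable_objective (hO.norm_mean_sub_le hβ))
    (fun x => ciInf_le hL x) (x := fun t ω => (stormState g x₁ ξ t ω).x)
    (d := fun t ω => (stormState g x₁ ξ t ω).d) (fun _ => rfl) stormState_x_succ
    (fun _ _ => rfl) (essBounded_stormState_d hO hβ hξ hlaw hind hρ1 hρ3)
    (integral_weighted_noise_sub_sq_le hO hβ hξ hlaw hind hρ1 hρ3) T
    (show 1 ≤ 1 + 8 * (σ ^ 2 * T) by linarith) (by
      -- The error bound involves the weight one step beyond `T`; `T + 1 ≤ 2 * T` turns `4` into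
      -- `8`.
      refine (integral_stormWeight_cube_le hO hξ hlaw hind hρ1 hρ3 (T + 1)).trans ?_
      push_cast
      nlinarith [mul_nonneg (sq_nonneg σ) (sub_nonneg.2 hT1)])
  have hVQ := rpow_mul_le_boundQ (σ := σ) (sub_nonneg.2 (ciInf_le hL x₁)) hσ hσ'
    (le_max_right β 2) hθ6 hy hV0.le hθ1 hV
  -- averaging over the output index
  have hGb (t : ℕ) : EssBounded μ fun ω => ‖G (stormState g x₁ ξ t ω).x‖ :=
    (essBounded_gradient_stormState hO hβ hξ hlaw hind hρ1 hρ3 t).norm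
  have hHm (t : ℕ) : Measurable fun s : ℕ → Ξ =>
      ‖G (metaStorm ⟨1, 1, 1, 1 / 2, 1 / 4⟩ g x₁ s t).x‖ ^ (6 / 7 : ℝ) := by
    rcases t with _ | t
    · exact (measurable_const : Measurable fun _ : ℕ → Ξ => ‖G x₁‖ ^ (6 / 7 : ℝ))
    · exact ((hO.measurable_mean.comp (measurable_stormState_x (ξ := fun i (s : ℕ → Ξ) => s i)
        hO.measurable measurable_pi_apply t)).norm).pow_const _
  obtain ⟨hi, hav⟩ := integral_uniform_index hτ hτu hτi hHm fun t ht => by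
    obtain ⟨s, rfl⟩ : ∃ s, t = s + 1 := ⟨t - 1, by have := (Finset.mem_Icc.1 ht).1; omega⟩
    exact (hGb s).rpow_const (by norm_num)
  simp only [hxout]
  refine ⟨hi, ?_⟩
  rw [hav]
  have hsum : ∑ t ∈ Finset.Icc 1 T, ∫ ω, ‖G (metaStorm ⟨1, 1, 1, 1 / 2, 1 / 4⟩ g x₁
      (fun t => ξ t ω) t).x‖ ^ (6 / 7 : ℝ) ∂μ =
      ∑ t ∈ Finset.range T, ∫ ω, (‖G (stormState g x₁ ξ t ω).x‖ ^ 2) ^ (3 / 7 : ℝ) ∂μ := by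
    rw [← Finset.Ico_add_one_right_eq_Icc, Finset.sum_Ico_eq_sum_range]
    refine Finset.sum_congr (by simp) fun t _ => integral_congr_ae (.of_forall fun ω => ?_)
    simp only
    rw [← Real.rpow_natCast, ← Real.rpow_mul (norm_nonneg _), add_comm 1 t]
    norm_num
  have hb (t : ℕ) : EssBounded μ fun ω => (‖G (stormState g x₁ ξ t ω).x‖ ^ 2) ^ (3 / 7 : ℝ) :=
    ((hGb t).pow 2).rpow_const (by norm_num)
  have hbs : EssBounded μ fun ω =>
      (∑ t ∈ Finset.range T, ‖G (stormState g x₁ ξ t ω).x‖ ^ 2) ^ (3 / 7 : ℝ) :=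
    (EssBounded.sum _ fun t _ => (hGb t).pow 2).rpow_const (by norm_num)
  rw [hsum, ← integral_finsetSum _ fun t _ => (hb t).integrable, ← integral_const_mul]
  have hmean := integral_mono (((EssBounded.sum (Finset.range T) fun t _ => hb t).const_mul
      (T : ℝ)⁻¹).integrable) (hbs.const_mul (1 / (T : ℝ) ^ (3 / 7 : ℝ))).integrable fun ω =>
    sum_rpow_le_mean (u := fun t => ‖G (stormState g x₁ ξ t ω).x‖ ^ 2) (fun _ => sq_nonneg _) hT
      (show (0 : ℝ) ≤ 3 / 7 by norm_num) (by norm_num)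
  refine hmean.trans ?_
  rw [integral_const_mul]
  set Q := boundQ₁ (F x₁ - ⨅ x, F x) σ σ' (max β 2) +
    boundQ₂ σ' (max β 2) * Real.log (1 + σ ^ 2 * T) ^ (6 / 7 : ℝ)
  have hT0 : (0 : ℝ) < T := by linarith
  calc 1 / (T : ℝ) ^ (3 / 7 : ℝ) *
        ∫ ω, (∑ t ∈ Finset.range T, ‖G (stormState g x₁ ξ t ω).x‖ ^ 2) ^ (3 / 7 : ℝ) ∂μ
      ≤ 1 / (T : ℝ) ^ (3 / 7 : ℝ) *
        (2 * ((1 + 8 * (σ ^ 2 * T)) ^ (1 / 7 : ℝ) * V ^ (6 / 7 : ℝ))) := by gcongr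
    _ = 2 * V ^ (6 / 7 : ℝ) * (1 / (T : ℝ) ^ (3 / 7 : ℝ) * (1 + 8 * (σ ^ 2 * T)) ^ (1 / 7 : ℝ)) := by
        ring
    _ ≤ 2 * (1300438 * Q) * (2 * (1 / (T : ℝ) ^ (3 / 7 : ℝ) + σ ^ (2 / 7 : ℝ) / (T : ℝ) ^ (2 / 7 : ℝ))) := by
        have h1 := rate_le hσ hT0
        have h2 : 0 ≤ 1300438 * Q := (Real.rpow_nonneg hV0.le _).trans hVQ
        gcongr
    _ = _ := by ring
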